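/- **Setting.** Let $n\ge 1$ and let $A\in\mathbb R^{n\times n}$ be symmetric with zero diagonal. The Ising model $\mathcal D(A,0)$ is the distribution on $\{-1,1\}^n$ with $\Pr[Z=z]\propto\exp\big(\sum_{i<j}A_{ij}z_iz_j\big)$, and its width is $\lambda(A)=\max_i\sum_j|A_{ij}|$. For $p=(p_1,\dots,p_n)\in[0,1/2)^n$, a flipped sample is $X=(C_1Z_1,\dots,C_nZ_n)$, where $Z\sim\mathcal D(A,0)$ and $C_1,\dots,C_n\in\{-1,1\}$ are independent of $Z$ and of each other with $\Pr[C_i=-1]=p_i$. **Estimator.** For $w\in\mathbb R^{2n-1}$ let $\Pi(w)_i=w_i-w_{n-1+i}$ for $i\in[n-1]$. Put $$\sigma(q,a,x)=\frac{(1-q)e^{ax}-qe^{-ax}}{1-2q},\qquad \tau(q,a,x)=\frac{(1-q)e^{ax}+qe^{-ax}}{1-2q},$$ $$h^i(w;X)=X_nX_i\,\tau\big(p_i,-\Pi(w)_iX_n,X_i\big)\prod_{j\ne i,n}\sigma\big(p_j,-\Pi(w)_jX_n,X_j\big),$$ $$g^i(w;X)=-\frac{(1-p_n)h^i(w;X)+p_nh^i(-w;X)}{1-2p_n},\qquad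 G(w;X)=\sum_{i=1}^{n-1}g^i(w;X)\,(e^i-e^{n-1+i})\in\mathbb R^{2n-1}.$$ **Algorithm** (inputs: $\lambda>0$, $p$, step size $\eta>0$, samples $X^1,\dots,X^T$). Set $w^1_a=\lambda/(2n-1)$ for all $a\in[2n-1]$; for $t=1,\dots,T$ put $c^t=\langle w^t,G(w^t;X^t)\rangle/\lambda$ and $w^{t+1}_a=w^t_a\big(1-\eta\,G(w^t;X^t)_a+\eta c^t\big)$ for all $a$; output $\bar w=\frac1T\sum_{t=1}^Tw^t$. **Theorem.** For every $p_{\max}<1/2$ and $\lambda_0>0$ there is a constant $C>0$, depending only on $p_{\max}$ and $\lambda_0$, such that the following holds. For all $n\ge1$, all $p$ with $0\le p_i\le p_{\max}$, all $\lambda\ge\lambda_0$ and all $T\in\mathbb N$ there is a step size $\eta>0$ (depending only on $p_{\max},\lambda_0,n,p,\lambda,T$) such that for all $\varepsilon>0$ and $\delta\in(0,1)$ with $$T\ \ge\ \lambda^4\,\log(n/\delta)\,\exp(C\lambda)\,\varepsilon^{-4}$$ and every Ising model $\mathcal D(A,0)$ on $n$ variables of width $\lambda(A)\le\lambda$, the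 algorithm run on $T$ independent flipped samples of $\mathcal D(A,0)$ returns $\bar w$ such that, with probability at least $1-\delta$, $$\big|\Pi(\bar w)_i-A_{ni}\big|\le\varepsilon\qquad\text{for all } i\in[n-1].$$ -/

import Mathlib

open MeasureTheory ProbabilityTheory

noncomputable section

namespace FlipIsing

/-- Spin configurations `{-1, 1}^n`; the group `ℤˣ = {1, -1}` is the set of spins. -/
abbrev Config (n : ℕ) : Type := Fin n → ℤˣ

/-- A spin as a real number. -/
def spin (s : ℤˣ) : ℝ := ((s : ℤ) : ℝ)

/-- The unnormalized Ising weight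
`exp (∑_{i < j} A_ij z_i z_j + ∑_i θ_i z_i)`: every unordered pair is counted once. -/
def isingWeight {n : ℕ} (A : Matrix (Fin n) (Fin n) ℝ) (θ : Fin n → ℝ) (z : Config n) : ℝ :=
  Real.exp ((∑ i, ∑ j ∈ Finset.Ioi i, A i j * spin (z i) * spin (z j)) + ∑ i, θ i * spin (z i))

/-- The partition function. -/
def partitionFn {n : ℕ} (A : Matrix (Fin n) (Fin n) ℝ) (θ : Fin n → ℝ) : ℝ :=
  ∑ z : Config n, isingWeight A θ z

/-- The Ising model `D(A, θ)` as a distribution on `{-1, 1}^n`. -/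
def ising {n : ℕ} (A : Matrix (Fin n) (Fin n) ℝ) (θ : Fin n → ℝ) : Measure (Config n) :=
  ∑ z : Config n, ENNReal.ofReal (isingWeight A θ z / partitionFn A θ) • Measure.dirac z

/-- The width `max_i (∑_j |A_ij| + |θ_i|)`. -/
def width {n : ℕ} (A : Matrix (Fin n) (Fin n) ℝ) (θ : Fin n → ℝ) : ℝ :=
  ⨆ i, ((∑ j, |A i j|) + |θ i|)

/-- The distribution `Rad(q)` on `{-1, 1}`, with probability `q` of drawing `1`. -/
def rad (q : ℝ) : Measure ℤˣ :=
  ENNReal.ofReal q • Measure.dirac 1 + ENNReal.ofReal (1 - q) • Measure.dirac (-1)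

/-- The corrupted distribution: draw `Z ∼ D(A, θ)` and, independently of `Z` and of each other,
`C_i ∼ Rad(1 - p_i)`; output `X` with `X_i = C_i Z_i`. -/
def flipped {n : ℕ} (A : Matrix (Fin n) (Fin n) ℝ) (θ p : Fin n → ℝ) : Measure (Config n) :=
  ((ising A θ).prod (Measure.pi fun i => rad (1 - p i))).map fun zc i => zc.2 i * zc.1 i

/-- The coordinates `1, …, 2k+1` of `ℝ^(2k+1)`: `inl i` is the coordinate `i`,
`inr (inl i)` is the coordinate `k + i`, and `inr (inr ())` is the coordinate `2k + 1`. -/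
abbrev Coord (k : ℕ) : Type := Fin k ⊕ Fin k ⊕ Unit

/-- The map from the simplex to the `ℓ¹` ball, `w ↦ (w_i - w_{k+i})_i`. -/
def toBall {k : ℕ} (w : Coord k → ℝ) (i : Fin k) : ℝ :=
  w (Sum.inl i) - w (Sum.inr (Sum.inl i))

/-- `σ(p, a, ·)`: from a flipped `x`, an unbiased estimator of `exp (a z)`; it is
`((1 - p) f(x) - p f(-x)) / (1 - 2p)` for `f(x) = exp (a x)`. -/
def sigma (p a x : ℝ) : ℝ :=
  ((1 - p) * Real.exp (a * x) - p * Real.exp (-(a * x))) / (1 - 2 * p)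

/-- From a flipped `x`, an unbiased estimator of `z exp (a z)`; it is
`((1 - p) f(x) - p f(-x)) / (1 - 2p)` for `f(x) = x exp (a x)`. -/
def sigmaLin (p a x : ℝ) : ℝ :=
  ((1 - p) * (x * Real.exp (a * x)) - p * (-x * Real.exp (-(a * x)))) / (1 - 2 * p)

/-- The vertices are `Fin (k + 1)`; the vertex whose neighbourhood is learned is `Fin.last k`,
and the others are `i.castSucc` for `i : Fin k`. -/
def hFlip {k : ℕ} (p : Fin (k + 1) → ℝ) (i : Fin k) (w : Coord k → ℝ) (x : Config (k + 1)) : ℝ :=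
  spin (x (Fin.last k)) *
    sigmaLin (p i.castSucc) (-(toBall w i * spin (x (Fin.last k)))) (spin (x i.castSucc)) *
    ∏ j ∈ Finset.univ.erase i,
      sigma (p j.castSucc) (-(toBall w j * spin (x (Fin.last k)))) (spin (x j.castSucc))

def gFlip {k : ℕ} (p : Fin (k + 1) → ℝ) (i : Fin k) (w : Coord k → ℝ) (x : Config (k + 1)) : ℝ :=
  -(((1 - p (Fin.last k)) * hFlip p i w x + p (Fin.last k) * hFlip p i (-w) x) /
    (1 - 2 * p (Fin.last k)))

/-- The gradient estimator `∑_i g^i (e^i - e^{k+i})`. -/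
def GFlip {k : ℕ} (p : Fin (k + 1) → ℝ) (w : Coord k → ℝ) (x : Config (k + 1)) : Coord k → ℝ
  | Sum.inl i => gFlip p i w x
  | Sum.inr (Sum.inl i) => -gFlip p i w x
  | Sum.inr (Sum.inr _) => 0

/-- One update: `w_a ↦ w_a (1 - η G_a + η ⟨w, G⟩ / lam)`. -/
def smgStep {k : ℕ} (p : Fin (k + 1) → ℝ) (lam η : ℝ) (w : Coord k → ℝ) (x : Config (k + 1)) :
    Coord k → ℝ :=
  fun a => w a * (1 - η * GFlip p w x a + η * ((∑ b, w b * GFlip p w x b) / lam))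

/-- The iterates: `smgIter … x t` is `w^{t+1}`, starting from the constant vector
`w^1 = lam / (2k + 1)` and consuming one sample per round while there are any. -/
def smgIter {k T : ℕ} (p : Fin (k + 1) → ℝ) (lam η : ℝ) (x : Fin T → Config (k + 1)) :
    ℕ → Coord k → ℝ
  | 0 => fun _ => lam / (2 * k + 1)
  | t + 1 =>
    if h : t < T then smgStep p lam η (smgIter p lam η x t) (x ⟨t, h⟩)
    else smgIter p lam η x t

/-- The output `(1/T) ∑_{t=1}^T w^t` of the algorithm on `T` samples. -/
def smgOutput {k T : ℕ} (p : Fin (k + 1) → ℝ) (lam η : ℝ) (x : Fin T → Config (k + 1)) :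
    Coord k → ℝ :=
  fun a => (1 / (T : ℝ)) * ∑ t ∈ Finset.range T, smgIter p lam η x t a

end FlipIsing

end

namespace FlipIsing

/-! The row of `A` at the last vertex minimizes the convex interaction screening objective `screen A
v`, the mean of exp(-z_n ∑_j v_j z_j): at v = `lastRow A` the exponential cancels from the Gibbs
weight every term containing z_n. The algorithm is a multiplicative-weights descent on this
objective over a simplex parametrizing the ℓ¹ ball of radius lam, fed with gradient estimates
computed from flipped samples.

The estimates are unbiased (`sum_flippedMass_gFlip`), because f ↦ ((1-q) f(x) - q f(-x)) / (1-2q)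
inverts a spin flip of probability q and can be applied to each vertex separately. They are bounded
by B = c² exp(c lam) with c = 1 / (1 - 2 pmax), independently of the number of vertices
(`abs_gFlip_le`): each factor satisfies |σ| ≤ exp(c|a|) with no constant in front, so the product
only sees the ℓ¹ norm of the coupling vector.

A relative-entropy potential gives regret of order lam B √(T log n) (`regret_le`,
`regret_bound_le`). Replacing estimated gradients by true ones costs a martingale with increments at
most 4 lam B, controlled by Azuma–Hoeffding (`azuma_finite`). By convexity (`screen_sub_le`) the
summed excess of the objective is then of order lam B √(T log(n/δ)), and quadratic growth in every
single coordinate (`screen_sub_screen_lastRow_ge`) turns this into a bound on T times the squared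
error of the averaged iterate (`sq_error_le`). Hence error² ≲ T^(-1/2), which is the ε⁻⁴. Only one
scalar martingale is involved, so no union bound over coordinates is needed; log n comes from the
entropy of the uniform starting point. -/

/-! ### The estimator is unbiased -/

/-- The probability of the configuration `z` under the Ising model without external field. -/
noncomputable def isingProb {n : ℕ} (A : Matrix (Fin n) (Fin n) ℝ) (z : Config n) : ℝ :=
  isingWeight A 0 z / partitionFn A 0

/-- The mass function of `rad (1 - q)`. -/
noncomputable def radMass (q : ℝ) (s : ℤˣ) : ℝ := if s = 1 then 1 - q else q

/-- The mass function of the flipped distribution. -/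
noncomputable def flippedMass {n : ℕ} (A : Matrix (Fin n) (Fin n) ℝ) (p : Fin n → ℝ)
    (x : Config n) : ℝ :=
  ∑ z : Config n, isingProb A z * ∏ i, radMass (p i) (x i * z i)

/-- The exponent `z_n ∑_j v_j z_j` of the interaction screening objective. -/
noncomputable def exponent {k : ℕ} (v : Fin k → ℝ) (z : Config (k + 1)) : ℝ :=
  spin (z (Fin.last k)) * ∑ j, v j * spin (z j.castSucc)

/-- The interaction screening objective. -/
noncomputable def screen {k : ℕ} (A : Matrix (Fin (k + 1)) (Fin (k + 1)) ℝ) (v : Fin k → ℝ) : ℝ :=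
  ∑ z, isingProb A z * Real.exp (-exponent v z)

/-- The partial derivatives of the interaction screening objective. -/
noncomputable def screenGrad {k : ℕ} (A : Matrix (Fin (k + 1)) (Fin (k + 1)) ℝ) (v : Fin k → ℝ)
    (i : Fin k) : ℝ :=
  ∑ z, isingProb A z *
    -(spin (z (Fin.last k)) * spin (z i.castSucc) * Real.exp (-exponent v z))

@[simp] lemma spin_one : spin 1 = 1 := by simp [spin]

@[simp] lemma spin_neg (s : ℤˣ) : spin (-s) = -spin s := by simp [spin]

lemma spin_mul_self (s : ℤˣ) : spin s * spin s = 1 := by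
  rcases Int.units_eq_one_or s with rfl | rfl <;> simp

lemma abs_spin (s : ℤˣ) : |spin s| = 1 := by
  rcases Int.units_eq_one_or s with rfl | rfl <;> simp

lemma isingWeight_pos {n : ℕ} (A : Matrix (Fin n) (Fin n) ℝ) (θ : Fin n → ℝ) (z : Config n) :
    0 < isingWeight A θ z := Real.exp_pos _

lemma partitionFn_pos {n : ℕ} (A : Matrix (Fin n) (Fin n) ℝ) (θ : Fin n → ℝ) :
    0 < partitionFn A θ :=
  Finset.sum_pos (fun z _ => isingWeight_pos A θ z) Finset.univ_nonempty

lemma isingProb_pos {n : ℕ} (A : Matrix (Fin n) (Fin n) ℝ) (z : Config n) : 0 < isingProb A z :=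
  div_pos (isingWeight_pos A 0 z) (partitionFn_pos A 0)

lemma sum_isingProb {n : ℕ} (A : Matrix (Fin n) (Fin n) ℝ) : ∑ z, isingProb A z = 1 := by
  unfold isingProb
  rw [← Finset.sum_div]
  exact div_self (partitionFn_pos A 0).ne'

lemma radMass_nonneg {q : ℝ} (h0 : 0 ≤ q) (h1 : q ≤ 1) (s : ℤˣ) : 0 ≤ radMass q s := by
  unfold radMass
  split_ifs <;> linarith

lemma sum_radMass_mul (q : ℝ) (s : ℤˣ) : ∑ x, radMass q (x * s) = 1 := by
  rcases Int.units_eq_one_or s with rfl | rfl <;> simp [radMass]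

lemma flippedMass_nonneg {n : ℕ} (A : Matrix (Fin n) (Fin n) ℝ) {p : Fin n → ℝ}
    (h0 : ∀ i, 0 ≤ p i) (h1 : ∀ i, p i ≤ 1) (x : Config n) : 0 ≤ flippedMass A p x :=
  Finset.sum_nonneg fun z _ => mul_nonneg (isingProb_pos A z).le
    (Finset.prod_nonneg fun i _ => radMass_nonneg (h0 i) (h1 i) _)

lemma sum_flippedMass {n : ℕ} (A : Matrix (Fin n) (Fin n) ℝ) (p : Fin n → ℝ) :
    ∑ x, flippedMass A p x = 1 := by
  unfold flippedMass
  rw [Finset.sum_comm, ← sum_isingProb A]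
  refine Finset.sum_congr rfl fun z _ => ?_
  rw [← Finset.mul_sum, ← Fintype.prod_sum (fun i s => radMass (p i) (s * z i))]
  simp only [sum_radMass_mul, Finset.prod_const_one, mul_one]

/-- The flip acts on odd functions of a spin as multiplication by 1 - 2q and fixes even ones, so it
is invertible for q ≠ 1/2; `sigma` is the inverse applied to exp(a ·). -/
lemma sum_radMass_sigma {q : ℝ} (hq : 1 - 2 * q ≠ 0) (a : ℝ) (s : ℤˣ) :
    ∑ x, radMass q (x * s) * sigma q a (spin x) = Real.exp (a * spin s) := by
  have hd := mul_inv_cancel₀ hq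
  rcases Int.units_eq_one_or s with rfl | rfl <;> simp [radMass, sigma]
  · linear_combination Real.exp a * hd
  · linear_combination Real.exp (-a) * hd

lemma sum_radMass_sigmaLin {q : ℝ} (hq : 1 - 2 * q ≠ 0) (a : ℝ) (s : ℤˣ) :
    ∑ x, radMass q (x * s) * sigmaLin q a (spin x) = spin s * Real.exp (a * spin s) := by
  have hd := mul_inv_cancel₀ hq
  rcases Int.units_eq_one_or s with rfl | rfl <;> simp [radMass, sigmaLin]
  · linear_combination Real.exp a * hd
  · linear_combination -Real.exp (-a) * hd

lemma sum_config_succ {k : ℕ} (F : Config (k + 1) → ℝ) :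
    ∑ x, F x = ∑ s : ℤˣ, ∑ y : Config k, F (Fin.snoc (α := fun _ => ℤˣ) y s) := by
  rw [← Fintype.sum_prod_type' (f := fun s y => F (Fin.snoc (α := fun _ => ℤˣ) y s))]
  exact (Fintype.sum_equiv (Fin.snocEquiv fun _ : Fin (k + 1) => ℤˣ) _ _ fun _ => rfl).symm

lemma toBall_neg {k : ℕ} (w : Coord k → ℝ) (i : Fin k) : toBall (-w) i = -toBall w i := by
  simp [toBall]; ring

/-- The expectation of `hFlip` over all flips but the one at the last vertex. -/
lemma sum_radMass_hFlip {k : ℕ} {p : Fin (k + 1) → ℝ} (hp : ∀ i, 1 - 2 * p i ≠ 0) (i : Fin k)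
    (w : Coord k → ℝ) (z : Config (k + 1)) (s : ℤˣ) :
    ∑ y : Config k, (∏ j : Fin k, radMass (p j.castSucc) (y j * z j.castSucc)) *
        hFlip p i w (Fin.snoc (α := fun _ => ℤˣ) y s) =
      spin s * spin (z i.castSucc) *
        Real.exp (-(spin s * ∑ j, toBall w j * spin (z j.castSucc))) := by
  set a : Fin k → ℝ := fun j => -(toBall w j * spin s) with ha
  -- Vertex i carries the linear factor and all others the plain exponential; written as one family,
  -- the sum over configurations factors over the vertices.
  set f : (j : Fin k) → ℤˣ → ℝ := fun j x => radMass (p j.castSucc) (x * z j.castSucc) *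
    (if j = i then sigmaLin (p j.castSucc) (a j) (spin x) else sigma (p j.castSucc) (a j) (spin x))
    with hf
  have h1 : ∀ y : Config k, (∏ j : Fin k, radMass (p j.castSucc) (y j * z j.castSucc)) *
        hFlip p i w (Fin.snoc (α := fun _ => ℤˣ) y s) = spin s * ∏ j, f j (y j) := by
    intro y
    rw [hf, Finset.prod_mul_distrib, ← Finset.mul_prod_erase Finset.univ
      (fun j => if j = i then sigmaLin (p j.castSucc) (a j) (spin (y j))
        else sigma (p j.castSucc) (a j) (spin (y j))) (Finset.mem_univ i)]
    have : ∏ j ∈ Finset.univ.erase i, (if j = i then sigmaLin (p j.castSucc) (a j) (spin (y j))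
        else sigma (p j.castSucc) (a j) (spin (y j))) =
        ∏ j ∈ Finset.univ.erase i, sigma (p j.castSucc) (a j) (spin (y j)) :=
      Finset.prod_congr rfl fun j hj => by rw [if_neg (Finset.ne_of_mem_erase hj)]
    rw [this, if_pos rfl]
    simp only [hFlip, Fin.snoc_last, Fin.snoc_castSucc, ha]
    ring
  have h2 : ∀ j, ∑ x, f j x = (if j = i then spin (z j.castSucc) else 1) *
      Real.exp (a j * spin (z j.castSucc)) := by
    intro j
    simp only [hf]
    split_ifs
    · exact sum_radMass_sigmaLin (hp _) _ _
    · rw [one_mul]; exact sum_radMass_sigma (hp _) _ _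
  rw [Finset.sum_congr rfl fun y _ => h1 y, ← Finset.mul_sum, ← Fintype.prod_sum,
    Finset.prod_congr rfl fun j _ => h2 j, Finset.prod_mul_distrib, ← Real.exp_sum]
  simp only [Finset.prod_ite_eq', Finset.mem_univ, if_true]
  rw [mul_assoc]
  congr 3
  rw [Finset.mul_sum, ← Finset.sum_neg_distrib]
  exact Finset.sum_congr rfl fun j _ => by simp only [ha]; ring

/-- The remaining flip, at the last vertex, is inverted for f(s) = s exp(-s m). Since f(-s) = -s
exp(s m), reversing s amounts to replacing w by -w with a change of sign; this explains the plus
sign and the term `hFlip p i (-w)` in `gFlip`. -/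
theorem sum_flippedMass_gFlip {k : ℕ} (A : Matrix (Fin (k + 1)) (Fin (k + 1)) ℝ)
    {p : Fin (k + 1) → ℝ} (hp : ∀ i, 1 - 2 * p i ≠ 0) (w : Coord k → ℝ) (i : Fin k) :
    ∑ x, flippedMass A p x * gFlip p i w x = screenGrad A (toBall w) i := by
  have key : ∀ z : Config (k + 1), ∑ x : Config (k + 1),
      (∏ j, radMass (p j) (x j * z j)) * gFlip p i w x =
      -(spin (z (Fin.last k)) * spin (z i.castSucc) * Real.exp (-exponent (toBall w) z)) := by
    intro z
    have h := sum_radMass_hFlip hp i w z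
    have h' := sum_radMass_hFlip hp i (-w) z
    have hL := hp (Fin.last k)
    set q := p (Fin.last k)
    have inner : ∀ s : ℤˣ, ∑ y : Config k,
        (∏ j, radMass (p j) ((Fin.snoc (α := fun _ => ℤˣ) y s : Config (k + 1)) j * z j)) *
          gFlip p i w (Fin.snoc (α := fun _ => ℤˣ) y s) =
        radMass q (s * z (Fin.last k)) * -(((1 - q) * (spin s * spin (z i.castSucc) *
          Real.exp (-(spin s * ∑ j, toBall w j * spin (z j.castSucc)))) +
          q * (spin s * spin (z i.castSucc) *
          Real.exp (-(spin s * ∑ j, toBall (-w) j * spin (z j.castSucc))))) / (1 - 2 * q)) := by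
      intro s
      rw [← h s, ← h' s, Finset.mul_sum, Finset.mul_sum, ← Finset.sum_add_distrib,
        Finset.sum_div, ← Finset.sum_neg_distrib, Finset.mul_sum]
      refine Finset.sum_congr rfl fun y _ => ?_
      rw [Fin.prod_univ_castSucc]
      simp only [Fin.snoc_last, Fin.snoc_castSucc, gFlip]
      ring
    rw [sum_config_succ, Finset.sum_congr rfl fun s _ => inner s]
    have hneg : ∑ j, toBall (-w) j * spin (z j.castSucc) =
        -∑ j, toBall w j * spin (z j.castSucc) := by
      rw [← Finset.sum_neg_distrib]
      exact Finset.sum_congr rfl fun j _ => by rw [toBall_neg]; ring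
    rw [hneg]
    unfold exponent
    set m := ∑ j, toBall w j * spin (z j.castSucc)
    have hd := mul_inv_cancel₀ hL
    rcases Int.units_eq_one_or (z (Fin.last k)) with hz | hz <;> rw [hz] <;> simp [radMass]
    · linear_combination -(spin (z i.castSucc) * Real.exp (-m)) * hd
    · linear_combination spin (z i.castSucc) * Real.exp m * hd
  unfold flippedMass screenGrad
  simp_rw [Finset.sum_mul]
  rw [Finset.sum_comm]
  refine Finset.sum_congr rfl fun z _ => ?_
  rw [← key z, Finset.mul_sum]
  exact Finset.sum_congr rfl fun x _ => by ring

/-! ### The estimator is bounded -/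

lemma one_le_inv_one_sub {q c : ℝ} (hq0 : 0 ≤ q) (hq : 1 ≤ c * (1 - 2 * q)) (hc : 0 ≤ c) :
    1 ≤ c := by nlinarith

/-- The bound equals 1 at a = 0. A prefactor c would become c^k in the product over the vertices and
ruin the dependence on n. -/
lemma abs_sigma_le {q c : ℝ} (hq0 : 0 ≤ q) (hq1 : 0 < 1 - 2 * q) (hq : 1 ≤ c * (1 - 2 * q))
    (a : ℝ) (s : ℤˣ) : |sigma q a (spin s)| ≤ Real.exp (c * |a|) := by
  have hc0 : 0 ≤ c := by
    by_contra h
    nlinarith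
  have hc := one_le_inv_one_sub hq0 hq hc0
  have e : sigma q a (spin s) =
      Real.cosh (a * spin s) + (1 / (1 - 2 * q)) * Real.sinh (a * spin s) := by
    unfold sigma
    rw [Real.cosh_eq, Real.sinh_eq]
    linear_combination
      (Real.exp (a * spin s) + Real.exp (-(a * spin s))) / 2 * mul_inv_cancel₀ hq1.ne'
  have hinv : 1 / (1 - 2 * q) ≤ c := by rw [div_le_iff₀ hq1]; exact hq
  have habs : |a * spin s| = |a| := by rw [abs_mul, abs_spin, mul_one]
  have hsinh : Real.sinh |a| ≥ 0 := Real.sinh_nonneg_iff.mpr (abs_nonneg a)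
  -- The left side is exp|a| + (c - 1) sinh|a|. Since sinh|a| ≤ |a| exp|a|, it is at most exp|a| (1
  -- + (c - 1)|a|) ≤ exp(c|a|).
  have hexp : Real.cosh |a| + c * Real.sinh |a| ≤ Real.exp (c * |a|) := by
    have h1 : Real.exp |a| * (1 - (c - 1) * (- |a|)) ≤ Real.exp (c * |a|) := by
      have : Real.exp (c * |a|) = Real.exp |a| * Real.exp ((c - 1) * |a|) := by
        rw [← Real.exp_add]; ring_nf
      rw [this]
      refine mul_le_mul_of_nonneg_left ?_ (Real.exp_pos _).le
      have := Real.add_one_le_exp ((c - 1) * |a|)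
      linarith
    have h2 : Real.sinh |a| ≤ |a| * Real.exp |a| := by
      have h3 := Real.add_one_le_exp (-(2 * |a|))
      have h4 : Real.exp (-|a|) = Real.exp |a| * Real.exp (-(2 * |a|)) := by
        rw [← Real.exp_add]; ring_nf
      rw [Real.sinh_eq, h4]
      nlinarith [Real.exp_pos |a|]
    have h5 : Real.cosh |a| + Real.sinh |a| = Real.exp |a| := Real.cosh_add_sinh _
    nlinarith
  rw [e]
  calc |Real.cosh (a * spin s) + (1 / (1 - 2 * q)) * Real.sinh (a * spin s)|
      ≤ |Real.cosh (a * spin s)| + |(1 / (1 - 2 * q)) * Real.sinh (a * spin s)| := abs_add_le _ _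
    _ = Real.cosh |a| + (1 / (1 - 2 * q)) * Real.sinh |a| := by
        rw [abs_mul, abs_of_pos (Real.cosh_pos _), Real.abs_sinh, habs, ← Real.cosh_abs, habs,
          abs_of_pos (one_div_pos.mpr hq1)]
    _ ≤ Real.cosh |a| + c * Real.sinh |a| := by gcongr
    _ ≤ _ := hexp

lemma abs_sigmaLin_le {q c : ℝ} (hq0 : 0 ≤ q) (hq1 : 0 < 1 - 2 * q) (hq : 1 ≤ c * (1 - 2 * q))
    (a : ℝ) (s : ℤˣ) : |sigmaLin q a (spin s)| ≤ c * Real.exp (c * |a|) := by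
  have hc0 : 0 ≤ c := by
    by_contra h
    nlinarith
  have hc := one_le_inv_one_sub hq0 hq hc0
  have e : sigmaLin q a (spin s) = spin s *
      (((1 - q) * Real.exp (a * spin s) + q * Real.exp (-(a * spin s))) * (1 / (1 - 2 * q))) := by
    unfold sigmaLin; ring
  have hinv : 1 / (1 - 2 * q) ≤ c := by rw [div_le_iff₀ hq1]; exact hq
  have hinv0 : 0 < 1 / (1 - 2 * q) := one_div_pos.mpr hq1
  have habs : |a * spin s| = |a| := by rw [abs_mul, abs_spin, mul_one]
  have h1 : Real.exp (a * spin s) ≤ Real.exp |a| := Real.exp_le_exp.mpr (habs ▸ le_abs_self _)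
  have h2 : Real.exp (-(a * spin s)) ≤ Real.exp |a| :=
    Real.exp_le_exp.mpr (habs ▸ neg_le_abs _)
  have h3 : Real.exp |a| ≤ Real.exp (c * |a|) :=
    Real.exp_le_exp.mpr (by nlinarith [abs_nonneg a])
  have h4 := Real.exp_pos (a * spin s)
  have h5 := Real.exp_pos (-(a * spin s))
  have h6 : 0 ≤ (1 - q) * Real.exp (a * spin s) + q * Real.exp (-(a * spin s)) := by
    have : 0 ≤ 1 - q := by linarith
    positivity
  rw [e, abs_mul, abs_spin, one_mul, abs_of_nonneg (mul_nonneg h6 hinv0.le), mul_comm c]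
  refine mul_le_mul ?_ hinv hinv0.le (Real.exp_pos _).le
  have : 0 ≤ 1 - q := by linarith
  nlinarith

lemma abs_hFlip_le {k : ℕ} {p : Fin (k + 1) → ℝ} {c : ℝ} (hp0 : ∀ i, 0 ≤ p i)
    (hp1 : ∀ i, 0 < 1 - 2 * p i) (hpc : ∀ i, 1 ≤ c * (1 - 2 * p i)) (i : Fin k)
    (w : Coord k → ℝ) (x : Config (k + 1)) :
    |hFlip p i w x| ≤ c * Real.exp (c * ∑ j, |toBall w j|) := by
  set a : Fin k → ℝ := fun j => -(toBall w j * spin (x (Fin.last k))) with ha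
  have habs : ∀ j, |a j| = |toBall w j| := fun j => by
    simp only [ha, abs_neg, abs_mul, abs_spin, mul_one]
  have h1 := abs_sigmaLin_le (hp0 i.castSucc) (hp1 i.castSucc) (hpc i.castSucc) (a i)
    (x i.castSucc)
  have h2 : |∏ j ∈ Finset.univ.erase i, sigma (p j.castSucc) (a j) (spin (x j.castSucc))| ≤
      ∏ j ∈ Finset.univ.erase i, Real.exp (c * |a j|) := by
    rw [Finset.abs_prod]
    exact Finset.prod_le_prod (fun _ _ => abs_nonneg _) fun j _ =>
      abs_sigma_le (hp0 _) (hp1 _) (hpc _) _ _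
  have h3 : c * Real.exp (c * ∑ j, |toBall w j|) =
      (c * Real.exp (c * |a i|)) * ∏ j ∈ Finset.univ.erase i, Real.exp (c * |a j|) := by
    rw [mul_assoc, Finset.mul_prod_erase Finset.univ (fun j => Real.exp (c * |a j|))
      (Finset.mem_univ i), ← Real.exp_sum, Finset.mul_sum]
    simp only [habs]
  rw [h3]
  unfold hFlip
  rw [abs_mul, abs_mul, abs_spin, one_mul]
  exact mul_le_mul h1 h2 (abs_nonneg _) ((abs_nonneg _).trans h1)

/-- One factor c comes from the linear estimator at vertex i, the other from the division by 1 - 2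
p_n. -/
theorem abs_gFlip_le {k : ℕ} {p : Fin (k + 1) → ℝ} {c r : ℝ} (hp0 : ∀ i, 0 ≤ p i)
    (hp1 : ∀ i, 0 < 1 - 2 * p i) (hpc : ∀ i, 1 ≤ c * (1 - 2 * p i)) (hc : 0 ≤ c) (i : Fin k)
    (w : Coord k → ℝ) (hw : ∑ j, |toBall w j| ≤ r) (x : Config (k + 1)) :
    |gFlip p i w x| ≤ c ^ 2 * Real.exp (c * r) := by
  have h1 := abs_hFlip_le hp0 hp1 hpc i w x
  have h2 := abs_hFlip_le hp0 hp1 hpc i (-w) x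
  simp only [toBall_neg, abs_neg] at h2
  set q := p (Fin.last k)
  have hq1 : 0 < 1 - 2 * q := hp1 _
  have hq0 : 0 ≤ q := hp0 _
  have hq2 : 0 ≤ 1 - q := by linarith
  set H := c * Real.exp (c * ∑ j, |toBall w j|) with hH
  have hHle : H ≤ c * Real.exp (c * r) := by
    rw [hH]; gcongr
  have hnum : |(1 - q) * hFlip p i w x + q * hFlip p i (-w) x| ≤ H := by
    calc _ ≤ |(1 - q) * hFlip p i w x| + |q * hFlip p i (-w) x| := abs_add_le _ _
      _ = (1 - q) * |hFlip p i w x| + q * |hFlip p i (-w) x| := by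
          rw [abs_mul, abs_mul, abs_of_nonneg hq2, abs_of_nonneg hq0]
      _ ≤ (1 - q) * H + q * H := by gcongr
      _ = H := by ring
  unfold gFlip
  rw [abs_neg, abs_div, abs_of_pos hq1, div_le_iff₀ hq1]
  have hpos : 0 ≤ c * Real.exp (c * r) := by positivity
  calc _ ≤ H := hnum
    _ ≤ c * Real.exp (c * r) * 1 := by rw [mul_one]; exact hHle
    _ ≤ c * Real.exp (c * r) * (c * (1 - 2 * q)) := mul_le_mul_of_nonneg_left (hpc _) hpos
    _ = _ := by ring

/-! ### The interaction screening objective -/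

/-- The energy `∑_{i < j} A_ij z_i z_j`. -/
noncomputable def energy {n : ℕ} (A : Matrix (Fin n) (Fin n) ℝ) (z : Config n) : ℝ :=
  ∑ i, ∑ j ∈ Finset.Ioi i, A i j * spin (z i) * spin (z j)

/-- The configuration `z` with the spin at `m` reversed. -/
def reverse {n : ℕ} (m : Fin n) (z : Config n) : Config n := Function.update z m (-z m)

lemma reverse_self {n : ℕ} (m : Fin n) (z : Config n) : reverse m z m = -z m := by
  simp [reverse]

lemma reverse_of_ne {n : ℕ} {m j : Fin n} (h : j ≠ m) (z : Config n) : reverse m z j = z j := by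
  simp [reverse, h]

lemma reverse_involutive {n : ℕ} (m : Fin n) : Function.Involutive (reverse m) := fun z => by
  simp [reverse]

lemma sum_reverse {n : ℕ} (m : Fin n) (F : Config n → ℝ) : ∑ z, F (reverse m z) = ∑ z, F z :=
  Equiv.sum_comp (reverse_involutive m).toPerm F

lemma isingWeight_eq {n : ℕ} (A : Matrix (Fin n) (Fin n) ℝ) (z : Config n) :
    isingWeight A 0 z = Real.exp (energy A z) := by
  simp [isingWeight, energy]

/-- The symmetric double sum does not refer to the order of the vertices, so a single vertex can be
isolated in it. -/
lemma two_mul_energy {n : ℕ} {A : Matrix (Fin n) (Fin n) ℝ} (hA : A.IsSymm)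
    (hd : ∀ i, A i i = 0) (z : Config n) :
    2 * energy A z = ∑ i, ∑ j, A i j * spin (z i) * spin (z j) := by
  have h := Finset.sum_sum_Ioi_add_eq_sum_sum_off_diag
    (fun i j : Fin n => A i j * spin (z i) * spin (z j))
  have h2 : ∀ i, ∑ j, A i j * spin (z i) * spin (z j) =
      ∑ j ∈ {i}ᶜ, A j i * spin (z j) * spin (z i) := by
    intro i
    rw [← Finset.sum_add_sum_compl {i}, Finset.sum_singleton, hd i]
    simp only [zero_mul, zero_add]
    exact Finset.sum_congr rfl fun j _ => by rw [hA.apply i j]; ring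
  rw [Finset.sum_congr rfl fun i _ => h2 i, ← h, energy, Finset.mul_sum]
  refine Finset.sum_congr rfl fun i _ => ?_
  rw [Finset.mul_sum]
  exact Finset.sum_congr rfl fun j _ => by rw [hA.apply i j]; ring

lemma energy_reverse {n : ℕ} {A : Matrix (Fin n) (Fin n) ℝ} (hA : A.IsSymm)
    (hd : ∀ i, A i i = 0) (m : Fin n) (z : Config n) :
    energy A (reverse m z) = energy A z - 2 * (spin (z m) * ∑ j, A m j * spin (z j)) := by
  set s : Fin n → ℝ := fun i => spin (z i) with hs
  have hs' : ∀ i, spin (reverse m z i) = s i - (if i = m then 2 * s m else 0) := by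
    intro i
    by_cases h : i = m
    · subst h; rw [reverse_self, spin_neg, if_pos rfl]; ring
    · rw [reverse_of_ne h, if_neg h, sub_zero]
  have h1 := two_mul_energy hA hd z
  have h2 := two_mul_energy hA hd (reverse m z)
  simp only [hs'] at h2
  have h3 : ∀ i, ∑ j, A i j * (s i - (if i = m then 2 * s m else 0)) *
      (s j - (if j = m then 2 * s m else 0)) = (s i - (if i = m then 2 * s m else 0)) *
      ((∑ j, A i j * s j) - A i m * (2 * s m)) := by
    intro i
    have : ∑ j, A i j * (if j = m then 2 * s m else 0) = A i m * (2 * s m) := by simp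
    rw [← this, ← Finset.sum_sub_distrib, Finset.mul_sum]
    exact Finset.sum_congr rfl fun j _ => by ring
  have h4 : ∑ i, (s i - (if i = m then 2 * s m else 0)) *
      ((∑ j, A i j * s j) - A i m * (2 * s m)) =
      (∑ i, ∑ j, A i j * s i * s j) - 2 * s m * (∑ i, A m i * s i)
        - 2 * s m * ((∑ j, A m j * s j) - A m m * (2 * s m)) := by
    have e1 : ∑ i, (if i = m then 2 * s m else 0) * ((∑ j, A i j * s j) - A i m * (2 * s m)) =
        2 * s m * ((∑ j, A m j * s j) - A m m * (2 * s m)) := by simp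
    rw [← e1, Finset.mul_sum, ← Finset.sum_sub_distrib, ← Finset.sum_sub_distrib]
    refine Finset.sum_congr rfl fun i _ => ?_
    have e2 : ∑ j, A i j * s i * s j = s i * ∑ j, A i j * s j := by
      rw [Finset.mul_sum]; exact Finset.sum_congr rfl fun j _ => by ring
    rw [e2, hA.apply i m]
    ring
  rw [Finset.sum_congr rfl fun i _ => h3 i, h4, hd m] at h2
  linarith

lemma exponent_add {k : ℕ} (u v : Fin k → ℝ) (z : Config (k + 1)) :
    exponent (u + v) z = exponent u z + exponent v z := by
  simp only [exponent, Pi.add_apply, add_mul, Finset.sum_add_distrib, mul_add]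

lemma exponent_reverse_last {k : ℕ} (v : Fin k → ℝ) (z : Config (k + 1)) :
    exponent v (reverse (Fin.last k) z) = -exponent v z := by
  simp only [exponent, reverse_self, spin_neg, neg_mul, neg_inj]
  congr 1
  exact Finset.sum_congr rfl fun j _ => by rw [reverse_of_ne (Fin.castSucc_lt_last j).ne]

lemma exponent_reverse_castSucc {k : ℕ} (v : Fin k → ℝ) (i : Fin k) (z : Config (k + 1)) :
    exponent v (reverse i.castSucc z) =
      exponent v z - 2 * (spin (z (Fin.last k)) * (v i * spin (z i.castSucc))) := by
  have h : ∀ j, v j * spin (reverse i.castSucc z j.castSucc) =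
      v j * spin (z j.castSucc) - (if j = i then 2 * (v i * spin (z i.castSucc)) else 0) := by
    intro j
    by_cases hj : j = i
    · subst hj; rw [reverse_self, spin_neg, if_pos rfl]; ring
    · rw [reverse_of_ne (fun h => hj (Fin.castSucc_injective k h)), if_neg hj, sub_zero]
  unfold exponent
  rw [reverse_of_ne (Fin.castSucc_lt_last i).ne', Finset.sum_congr rfl fun j _ => h j,
    Finset.sum_sub_distrib, Finset.sum_ite_eq' Finset.univ i, if_pos (Finset.mem_univ i)]
  ring

lemma abs_spin_mul_sum_le {n : ℕ} (s : ℤˣ) (a : Fin n → ℝ) (z : Config n) :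
    |spin s * ∑ j, a j * spin (z j)| ≤ ∑ j, |a j| := by
  rw [abs_mul, abs_spin, one_mul]
  refine (Finset.abs_sum_le_sum_abs _ _).trans (Finset.sum_le_sum fun j _ => ?_)
  rw [abs_mul, abs_spin, mul_one]

/-- The couplings of the last vertex. -/
def lastRow {k : ℕ} (A : Matrix (Fin (k + 1)) (Fin (k + 1)) ℝ) (i : Fin k) : ℝ :=
  A (Fin.last k) i.castSucc

lemma exponent_lastRow {k : ℕ} {A : Matrix (Fin (k + 1)) (Fin (k + 1)) ℝ}
    (hd : ∀ i, A i i = 0) (z : Config (k + 1)) :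
    exponent (lastRow A) z = spin (z (Fin.last k)) * ∑ j, A (Fin.last k) j * spin (z j) := by
  rw [Fin.sum_univ_castSucc, hd]
  simp [exponent, lastRow]

lemma one_add_sq_div_two_le_cosh (x : ℝ) : 1 + x ^ 2 / 2 ≤ Real.cosh x := by
  have h1 : (x / 2) ^ 2 ≤ Real.sinh (x / 2) ^ 2 := by
    rw [sq_le_sq, Real.abs_sinh]
    exact Real.self_le_sinh_iff.mpr (abs_nonneg _)
  have h2 := Real.cosh_two_mul (x / 2)
  rw [mul_div_cancel₀ x two_ne_zero, Real.cosh_sq] at h2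
  rw [h2]
  linarith

/-- Quadratic growth of the interaction screening objective around its minimizer. -/
theorem screen_sub_screen_lastRow_ge {k : ℕ} {A : Matrix (Fin (k + 1)) (Fin (k + 1)) ℝ}
    (hA : A.IsSymm) (hd : ∀ i, A i i = 0) {lam : ℝ} (hlam : ∀ i, ∑ j, |A i j| ≤ lam)
    (v : Fin k → ℝ) (i : Fin k) :
    Real.exp (-(5 * lam)) * (v i - lastRow A i) ^ 2 / 2 ≤
      screen A v - screen A (lastRow A) := by
  set d : Fin k → ℝ := v - lastRow A with hdv
  set R : Config (k + 1) → ℝ := fun z => isingProb A z * Real.exp (-exponent (lastRow A) z)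
    with hR
  have hRpos : ∀ z, 0 < R z := fun z => mul_pos (isingProb_pos A z) (Real.exp_pos _)
  have hRform : ∀ z, R z = Real.exp (energy A z - exponent (lastRow A) z) / partitionFn A 0 := by
    intro z
    simp only [hR, isingProb, isingWeight_eq]
    rw [sub_eq_add_neg, Real.exp_add]
    ring
  -- In `R` the tilt has removed all couplings of the last vertex, so its spin is symmetric given
  -- the others.
  have hRlast : ∀ z, R (reverse (Fin.last k) z) = R z := by
    intro z
    rw [hRform, hRform, energy_reverse hA hd, exponent_reverse_last, exponent_lastRow hd]
    congr 2
    ring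
  -- Reversing the spin at i lowers the energy by at most 2 lam, and changes the tilt by 2|A_ni| ≤ 2
  -- lam.
  have hRi : ∀ z, Real.exp (-(4 * lam)) * R z ≤ R (reverse i.castSucc z) := by
    intro z
    rw [hRform, hRform, ← mul_div_assoc, ← Real.exp_add]
    refine div_le_div_of_nonneg_right (Real.exp_le_exp.mpr ?_) (partitionFn_pos A 0).le
    rw [energy_reverse hA hd, exponent_reverse_castSucc]
    have h1 := (le_abs_self _).trans ((abs_spin_mul_sum_le (z i.castSucc) (A i.castSucc) z).trans
      (hlam _))
    have h2 : |spin (z (Fin.last k)) * (lastRow A i * spin (z i.castSucc))| ≤ lam := by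
      rw [abs_mul, abs_mul, abs_spin, abs_spin, one_mul, mul_one]
      exact (Finset.single_le_sum (f := fun j => |A (Fin.last k) j|) (fun _ _ => abs_nonneg _)
        (Finset.mem_univ i.castSucc)).trans (hlam _)
    have h3 := neg_le_of_abs_le h2
    linarith
  have hRsum : Real.exp (-lam) ≤ ∑ z, R z := by
    rw [← mul_one (Real.exp (-lam)), ← sum_isingProb A, Finset.mul_sum]
    refine Finset.sum_le_sum fun z _ => ?_
    simp only [hR]
    rw [mul_comm]
    refine mul_le_mul_of_nonneg_left (Real.exp_le_exp.mpr ?_) (isingProb_pos A z).le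
    rw [exponent_lastRow hd]
    have := (le_abs_self _).trans ((abs_spin_mul_sum_le (z (Fin.last k)) (A (Fin.last k)) z).trans
      (hlam _))
    linarith
  have hdiff : screen A v - screen A (lastRow A) = ∑ z, R z * (Real.exp (-exponent d z) - 1) := by
    unfold screen
    rw [← Finset.sum_sub_distrib]
    refine Finset.sum_congr rfl fun z _ => ?_
    have : v = lastRow A + d := by rw [hdv]; abel
    rw [this, exponent_add, neg_add, Real.exp_add]
    simp only [hR]
    ring
  -- Pairing z with its reversal at the last vertex turns exp(-x) - 1 into cosh x - 1 ≥ x²/2; this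
  -- symmetry is what kills the first-order term.
  have hcosh : ∑ z, R z * exponent d z ^ 2 ≤ 2 * (screen A v - screen A (lastRow A)) := by
    have h1 := sum_reverse (Fin.last k) fun z => R z * (Real.exp (-exponent d z) - 1)
    have h2 : 2 * (screen A v - screen A (lastRow A)) =
        ∑ z, R z * (Real.exp (-exponent d z) + Real.exp (exponent d z) - 2) := by
      rw [two_mul, hdiff]
      nth_rewrite 1 [← h1]
      rw [← Finset.sum_add_distrib]
      refine Finset.sum_congr rfl fun z _ => ?_
      rw [hRlast, exponent_reverse_last, neg_neg]
      ring
    rw [h2]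
    refine Finset.sum_le_sum fun z _ => mul_le_mul_of_nonneg_left ?_ (hRpos z).le
    have h3 := one_add_sq_div_two_le_cosh (exponent d z)
    rw [Real.cosh_eq] at h3
    linarith
  -- Reversing the spin at i moves the exponent of d by 2|d_i|, so the two squares add up to at
  -- least 2 d_i², and by `hRi` both configurations have comparable weight.
  have hvar : Real.exp (-(4 * lam)) * (∑ z, R z) * d i ^ 2 ≤ ∑ z, R z * exponent d z ^ 2 := by
    have h1 := sum_reverse i.castSucc fun z => R z * exponent d z ^ 2
    have h2 : 2 * ∑ z, R z * exponent d z ^ 2 = ∑ z, (R z * exponent d z ^ 2 +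
        R (reverse i.castSucc z) * exponent d (reverse i.castSucc z) ^ 2) := by
      rw [two_mul, Finset.sum_add_distrib, h1]
    have h3 : 2 * (Real.exp (-(4 * lam)) * (∑ z, R z) * d i ^ 2) =
        ∑ z, Real.exp (-(4 * lam)) * R z * (2 * d i ^ 2) := by
      rw [← Finset.sum_mul, ← Finset.mul_sum]; ring
    have hlam0 : 0 ≤ lam := (Finset.sum_nonneg fun j _ => abs_nonneg _).trans (hlam 0)
    have hle : ∑ z, Real.exp (-(4 * lam)) * R z * (2 * d i ^ 2) ≤
        ∑ z, (R z * exponent d z ^ 2 +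
        R (reverse i.castSucc z) * exponent d (reverse i.castSucc z) ^ 2) := by
      refine Finset.sum_le_sum fun z _ => ?_
      set x := exponent d z
      set x' := exponent d (reverse i.castSucc z) with hx'
      have hxx : x - x' = 2 * (spin (z (Fin.last k)) * (d i * spin (z i.castSucc))) := by
        rw [hx', exponent_reverse_castSucc]; ring
      have hsq : (x - x') ^ 2 = 4 * d i ^ 2 := by
        rw [hxx]
        linear_combination 4 * d i ^ 2 * spin (z i.castSucc) ^ 2 *
          spin_mul_self (z (Fin.last k)) + 4 * d i ^ 2 * spin_mul_self (z i.castSucc)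
      have hE : Real.exp (-(4 * lam)) ≤ 1 := Real.exp_le_one_iff.mpr (by linarith)
      have hr : Real.exp (-(4 * lam)) * R z ≤ R z := by nlinarith [hRpos z]
      have hr' := hRi z
      have hp : 0 < Real.exp (-(4 * lam)) * R z := mul_pos (Real.exp_pos _) (hRpos z)
      have hb : 2 * d i ^ 2 ≤ x ^ 2 + x' ^ 2 := by nlinarith [sq_nonneg (x + x')]
      calc _ ≤ Real.exp (-(4 * lam)) * R z * (x ^ 2 + x' ^ 2) := by gcongr
        _ = Real.exp (-(4 * lam)) * R z * x ^ 2 + Real.exp (-(4 * lam)) * R z * x' ^ 2 := by ring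
        _ ≤ _ := by gcongr
    linarith
  have hE : Real.exp (-(5 * lam)) = Real.exp (-(4 * lam)) * Real.exp (-lam) := by
    rw [← Real.exp_add]; ring_nf
  have hfin : Real.exp (-(5 * lam)) * d i ^ 2 ≤
      Real.exp (-(4 * lam)) * (∑ z, R z) * d i ^ 2 := by
    rw [hE]; gcongr
  have hdi : d i = v i - lastRow A i := rfl
  rw [← hdi]
  linarith

/-- The gradient inequality for the convex interaction screening objective. -/
theorem screen_sub_le {k : ℕ} (A : Matrix (Fin (k + 1)) (Fin (k + 1)) ℝ) (u v : Fin k → ℝ) :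
    screen A v - screen A u ≤ ∑ i, (v i - u i) * screenGrad A v i := by
  have h : ∑ i, (v i - u i) * screenGrad A v i =
      ∑ z, isingProb A z * ((exponent u z - exponent v z) * Real.exp (-exponent v z)) := by
    simp only [screenGrad, Finset.mul_sum]
    rw [Finset.sum_comm]
    refine Finset.sum_congr rfl fun z _ => ?_
    have hsub : exponent u z - exponent v z =
        ∑ i, -((v i - u i) * (spin (z (Fin.last k)) * spin (z i.castSucc))) := by
      simp only [exponent]
      rw [← mul_sub, ← Finset.sum_sub_distrib, Finset.mul_sum]
      exact Finset.sum_congr rfl fun i _ => by ring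
    rw [hsub, Finset.sum_mul, Finset.mul_sum]
    exact Finset.sum_congr rfl fun i _ => by ring
  rw [h, screen, screen, ← Finset.sum_sub_distrib]
  refine Finset.sum_le_sum fun z _ => ?_
  rw [← mul_sub]
  refine mul_le_mul_of_nonneg_left ?_ (isingProb_pos A z).le
  have h1 := Real.add_one_le_exp (exponent v z - exponent u z)
  have h2 : Real.exp (-exponent u z) =
      Real.exp (-exponent v z) * Real.exp (exponent v z - exponent u z) := by
    rw [← Real.exp_add]; ring_nf
  rw [h2]
  nlinarith [Real.exp_pos (-exponent v z)]

/-! ### The regret of the multiplicative update -/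

/-- The interior of the simplex of total mass `lam`. -/
def InSimplex {k : ℕ} (lam : ℝ) (w : Coord k → ℝ) : Prop := (∀ a, 0 < w a) ∧ ∑ a, w a = lam

lemma sum_coord {k : ℕ} (f : Coord k → ℝ) :
    ∑ a, f a =
      (∑ i, f (Sum.inl i)) + ((∑ i, f (Sum.inr (Sum.inl i))) + f (Sum.inr (Sum.inr ()))) := by
  simp [Fintype.sum_sum_type]

lemma InSimplex.sum_abs_toBall_le {k : ℕ} {lam : ℝ} {w : Coord k → ℝ} (hw : InSimplex lam w) :
    ∑ i, |toBall w i| ≤ lam := by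
  have h : ∀ i, |toBall w i| ≤ w (Sum.inl i) + w (Sum.inr (Sum.inl i)) := fun i => by
    have h1 := hw.1 (Sum.inl i)
    have h2 := hw.1 (Sum.inr (Sum.inl i))
    unfold toBall
    rw [abs_le]
    constructor <;> linarith
  have h3 := hw.1 (Sum.inr (Sum.inr ()))
  have h4 := hw.2
  rw [sum_coord] at h4
  calc _ ≤ ∑ i, (w (Sum.inl i) + w (Sum.inr (Sum.inl i))) := Finset.sum_le_sum fun i _ => h i
    _ ≤ lam := by rw [Finset.sum_add_distrib]; linarith

lemma sum_mul_GFlip {k : ℕ} (p : Fin (k + 1) → ℝ) (w u : Coord k → ℝ) (x : Config (k + 1)) :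
    ∑ a, u a * GFlip p w x a = ∑ i, toBall u i * gFlip p i w x := by
  rw [sum_coord]
  simp only [GFlip, toBall, mul_zero, add_zero]
  rw [← Finset.sum_add_distrib]
  exact Finset.sum_congr rfl fun i _ => by ring

lemma abs_GFlip_le {k : ℕ} {p : Fin (k + 1) → ℝ} {w : Coord k → ℝ} {x : Config (k + 1)} {B : ℝ}
    (hB : 0 ≤ B) (h : ∀ i, |gFlip p i w x| ≤ B) (a : Coord k) : |GFlip p w x a| ≤ B := by
  rcases a with i | i | i
  · exact h i
  · simpa [GFlip] using h i
  · simpa [GFlip] using hB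

/-- The relative change of the coordinate `a` in one update. -/
noncomputable def relChange {k : ℕ} (p : Fin (k + 1) → ℝ) (lam η : ℝ) (w : Coord k → ℝ)
    (x : Config (k + 1)) (a : Coord k) : ℝ :=
  η * ((∑ b, w b * GFlip p w x b) / lam - GFlip p w x a)

lemma smgStep_eq {k : ℕ} (p : Fin (k + 1) → ℝ) (lam η : ℝ) (w : Coord k → ℝ)
    (x : Config (k + 1)) (a : Coord k) :
    smgStep p lam η w x a = w a * (1 + relChange p lam η w x a) := by
  unfold smgStep relChange
  ring

lemma abs_relChange_le {k : ℕ} {p : Fin (k + 1) → ℝ} {lam η B : ℝ} {w : Coord k → ℝ}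
    {x : Config (k + 1)} (hlam : 0 < lam) (hη : 0 < η) (hB : 0 ≤ B) (hw : InSimplex lam w)
    (hg : ∀ i, |gFlip p i w x| ≤ B) (a : Coord k) :
    |relChange p lam η w x a| ≤ 2 * (η * B) := by
  have h1 : |∑ b, w b * GFlip p w x b| ≤ lam * B := by
    rw [← hw.2, Finset.sum_mul]
    refine (Finset.abs_sum_le_sum_abs _ _).trans (Finset.sum_le_sum fun b _ => ?_)
    rw [abs_mul, abs_of_pos (hw.1 b)]
    exact mul_le_mul_of_nonneg_left (abs_GFlip_le hB hg b) (hw.1 b).le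
  have h2 : |(∑ b, w b * GFlip p w x b) / lam| ≤ B := by
    rw [abs_div, abs_of_pos hlam, div_le_iff₀ hlam, mul_comm]
    exact h1
  have h3 := abs_sub ((∑ b, w b * GFlip p w x b) / lam) (GFlip p w x a)
  have h4 := abs_GFlip_le hB hg a
  unfold relChange
  rw [abs_mul, abs_of_pos hη]
  nlinarith

/-- The term ⟨w, G⟩ / lam makes the w-weighted mean of the relative changes vanish, so the mass is
conserved; 4ηB ≤ 1 keeps each relative change within 1/2, so positivity survives. -/
lemma InSimplex.smgStep {k : ℕ} {p : Fin (k + 1) → ℝ} {lam η B : ℝ} {w : Coord k → ℝ}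
    {x : Config (k + 1)} (hlam : 0 < lam) (hη : 0 < η) (hB : 0 ≤ B) (hηB : 4 * (η * B) ≤ 1)
    (hw : InSimplex lam w) (hg : ∀ i, |gFlip p i w x| ≤ B) :
    InSimplex lam (smgStep p lam η w x) := by
  constructor
  · intro a
    rw [smgStep_eq]
    have h := neg_le_of_abs_le (abs_relChange_le hlam hη hB hw hg a)
    exact mul_pos (hw.1 a) (by linarith)
  · simp only [smgStep_eq, relChange]
    have : ∀ a, w a * (1 + η * ((∑ b, w b * GFlip p w x b) / lam - GFlip p w x a)) =
        w a * (1 + η * ((∑ b, w b * GFlip p w x b) / lam)) - η * (w a * GFlip p w x a) :=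
      fun a => by ring
    rw [Finset.sum_congr rfl fun a _ => this a, Finset.sum_sub_distrib, ← Finset.sum_mul, hw.2,
      ← Finset.mul_sum]
    field_simp
    ring

lemma inSimplex_smgIter {k T : ℕ} {p : Fin (k + 1) → ℝ} {lam η B : ℝ} (hlam : 0 < lam)
    (hη : 0 < η) (hB : 0 ≤ B) (hηB : 4 * (η * B) ≤ 1)
    (hg : ∀ (w : Coord k → ℝ), InSimplex lam w → ∀ x i, |gFlip p i w x| ≤ B)
    (x : Fin T → Config (k + 1)) (t : ℕ) : InSimplex lam (smgIter p lam η x t) := by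
  induction t with
  | zero =>
    refine ⟨fun a => by simp only [smgIter]; positivity, ?_⟩
    simp only [smgIter, Finset.sum_const, Finset.card_univ, Fintype.card_sum, Fintype.card_fin,
      Fintype.card_unit, nsmul_eq_mul]
    push_cast
    field_simp
    ring
  | succ t ih =>
    rw [smgIter]
    split_ifs with h
    · exact ih.smgStep hlam hη hB hηB (hg _ ih _)
    · exact ih

lemma sub_two_mul_sq_le_log {y : ℝ} (hy : |y| ≤ 1 / 2) : y - 2 * y ^ 2 ≤ Real.log (1 + y) := by
  have h := Real.abs_log_sub_add_sum_range_le (x := -y) (by rw [abs_neg]; linarith) 1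
  simp only [Finset.range_one, Finset.sum_singleton, abs_neg, sub_neg_eq_add] at h
  norm_num at h
  have h2 : y ^ 2 / (1 - |y|) ≤ 2 * y ^ 2 := by
    rw [div_le_iff₀ (by linarith)]
    nlinarith [sq_nonneg y]
  have h3 := neg_le_of_abs_le (h.trans h2)
  linarith

/-- The potential ∑ u_a log w_a is, up to a constant, minus the relative entropy of u with respect
to w. With relative changes r_a, it grows by ∑ u_a log(1 + r_a) ≥ ∑ u_a (r_a - 2 r_a²). The linear
part is η ⟨w - u, G⟩ because u has mass lam, and |r_a| ≤ 2ηB gives the 8. -/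
lemma potential_step {k : ℕ} {p : Fin (k + 1) → ℝ} {lam η B : ℝ} {w u : Coord k → ℝ}
    {x : Config (k + 1)} (hlam : 0 < lam) (hη : 0 < η) (hB : 0 ≤ B) (hηB : 4 * (η * B) ≤ 1)
    (hw : InSimplex lam w) (hg : ∀ i, |gFlip p i w x| ≤ B) (hu : ∀ a, 0 ≤ u a)
    (hus : ∑ a, u a = lam) :
    η * ∑ i, (toBall w i - toBall u i) * gFlip p i w x ≤
      (∑ a, u a * Real.log (smgStep p lam η w x a)) - (∑ a, u a * Real.log (w a)) +
        8 * lam * η ^ 2 * B ^ 2 := by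
  have h1 : η * ∑ i, (toBall w i - toBall u i) * gFlip p i w x =
      ∑ a, u a * relChange p lam η w x a := by
    have e : ∀ a, u a * relChange p lam η w x a =
        u a * (η * ((∑ b, w b * GFlip p w x b) / lam)) - η * (u a * GFlip p w x a) := fun a => by
      unfold relChange; ring
    rw [Finset.sum_congr rfl fun a _ => e a, Finset.sum_sub_distrib, ← Finset.sum_mul, hus,
      ← Finset.mul_sum, sum_mul_GFlip, sum_mul_GFlip]
    simp only [sub_mul, Finset.sum_sub_distrib]
    field_simp
  have h2 : ∑ a, u a * relChange p lam η w x a - 8 * lam * η ^ 2 * B ^ 2 ≤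
      ∑ a, (u a * Real.log (smgStep p lam η w x a) - u a * Real.log (w a)) := by
    have e : 8 * lam * η ^ 2 * B ^ 2 = ∑ a, u a * (8 * η ^ 2 * B ^ 2) := by
      rw [← Finset.sum_mul, hus]; ring
    rw [e, ← Finset.sum_sub_distrib]
    refine Finset.sum_le_sum fun a _ => ?_
    rw [← mul_sub, ← mul_sub]
    refine mul_le_mul_of_nonneg_left ?_ (hu a)
    have hr := abs_relChange_le hlam hη hB hw hg a
    have hr2 := sub_two_mul_sq_le_log (hr.trans (by linarith))
    have hpos : 0 < 1 + relChange p lam η w x a := by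
      have := neg_le_of_abs_le hr
      linarith
    rw [smgStep_eq, Real.log_mul (hw.1 a).ne' hpos.ne']
    have hsq : relChange p lam η w x a ^ 2 ≤ (2 * (η * B)) ^ 2 := sq_le_sq' (neg_le_of_abs_le hr)
      (le_of_abs_le hr)
    nlinarith
  rw [Finset.sum_sub_distrib] at h2
  linarith

/-- A point of the simplex that is mapped to a given point of the `ℓ¹` ball. -/
noncomputable def liftBall {k : ℕ} (lam : ℝ) (v : Fin k → ℝ) : Coord k → ℝ
  | Sum.inl i => max (v i) 0
  | Sum.inr (Sum.inl i) => max (-v i) 0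
  | Sum.inr (Sum.inr _) => lam - ∑ i, |v i|

lemma toBall_liftBall {k : ℕ} (lam : ℝ) (v : Fin k → ℝ) (i : Fin k) :
    toBall (liftBall lam v) i = v i := by
  simp only [toBall, liftBall]
  rcases le_total 0 (v i) with h | h
  · rw [max_eq_left h, max_eq_right (by linarith), sub_zero]
  · rw [max_eq_right h, max_eq_left (by linarith)]; ring

lemma liftBall_nonneg {k : ℕ} {lam : ℝ} {v : Fin k → ℝ} (hv : ∑ i, |v i| ≤ lam) (a : Coord k) :
    0 ≤ liftBall lam v a := by
  rcases a with i | i | i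
  · exact le_max_right _ _
  · exact le_max_right _ _
  · exact sub_nonneg.mpr hv

lemma sum_liftBall {k : ℕ} (lam : ℝ) (v : Fin k → ℝ) : ∑ a, liftBall lam v a = lam := by
  rw [sum_coord]
  simp only [liftBall]
  have : ∑ i, |v i| = ∑ i, max (v i) 0 + ∑ i, max (-v i) 0 := by
    rw [← Finset.sum_add_distrib]
    refine Finset.sum_congr rfl fun i _ => ?_
    rcases le_total 0 (v i) with h | h
    · rw [max_eq_left h, max_eq_right (by linarith), add_zero, abs_of_nonneg h]
    · rw [max_eq_right h, max_eq_left (by linarith), zero_add, abs_of_nonpos h]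
  rw [this]
  ring

/-- The steps of the potential telescope. Its final value is at most lam log lam since every
coordinate is at most lam, and at the uniform start it is smaller than that by exactly lam log(2k +
1). -/
theorem regret_le {k T : ℕ} {p : Fin (k + 1) → ℝ} {lam η B : ℝ} (hlam : 0 < lam)
    (hη : 0 < η) (hB : 0 ≤ B) (hηB : 4 * (η * B) ≤ 1)
    (hg : ∀ (w : Coord k → ℝ), InSimplex lam w → ∀ x i, |gFlip p i w x| ≤ B)
    (x : Fin T → Config (k + 1)) {v : Fin k → ℝ} (hv : ∑ i, |v i| ≤ lam) :
    η * ∑ t : Fin T, ∑ i, (toBall (smgIter p lam η x t) i - v i) *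
        gFlip p i (smgIter p lam η x t) (x t) ≤
      lam * Real.log (2 * k + 1) + T * (8 * lam * η ^ 2 * B ^ 2) := by
  set u := liftBall lam v
  have hw := inSimplex_smgIter hlam hη hB hηB hg x
  set Φ : ℕ → ℝ := fun t => ∑ a, u a * Real.log (smgIter p lam η x t a) with hΦ
  have hstep : ∀ t : Fin T, η * ∑ i, (toBall (smgIter p lam η x t) i - v i) *
        gFlip p i (smgIter p lam η x t) (x t) ≤
      (Φ (t + 1) - Φ t) + 8 * lam * η ^ 2 * B ^ 2 := by
    intro t
    have h := potential_step hlam hη hB hηB (hw t) (hg _ (hw t) (x t)) (liftBall_nonneg hv)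
      (sum_liftBall lam v)
    simp only [toBall_liftBall] at h
    have e : smgIter p lam η x (t + 1) = smgStep p lam η (smgIter p lam η x t) (x t) := by
      rw [smgIter, dif_pos t.2]
    simp only [hΦ, e]
    exact h
  have htel : ∑ t : Fin T, (Φ (t + 1) - Φ t) = Φ T - Φ 0 := by
    rw [← Finset.sum_range_sub, Finset.sum_range]
  have hTop : Φ T ≤ lam * Real.log lam := by
    nth_rewrite 1 [← sum_liftBall lam v]
    rw [Finset.sum_mul]
    refine Finset.sum_le_sum fun a _ => mul_le_mul_of_nonneg_left ?_ (liftBall_nonneg hv a)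
    refine Real.log_le_log ((hw T).1 a) ?_
    exact (Finset.single_le_sum (fun b _ => ((hw T).1 b).le) (Finset.mem_univ a)).trans_eq (hw T).2
  have hBot : Φ 0 = lam * Real.log lam - lam * Real.log (2 * k + 1) := by
    simp only [hΦ, smgIter]
    rw [← Finset.sum_mul, sum_liftBall, Real.log_div hlam.ne' (by positivity)]
    ring
  rw [Finset.mul_sum]
  refine (Finset.sum_le_sum fun t _ => hstep t).trans ?_
  rw [Finset.sum_add_distrib, htel, Finset.sum_const, Finset.card_univ, Fintype.card_fin,
    nsmul_eq_mul]
  linarith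

/-! ### The Azuma–Hoeffding inequality on a finite product space -/

section Azuma

variable {α : Type*} [Fintype α]

/-- Resampling one coordinate does not change an expectation over a product distribution. -/
lemma sum_prod_mul_eq_resample {ι : Type*} [Fintype ι] [DecidableEq ι] {q : α → ℝ}
    (hq : ∑ a, q a = 1) (m : ι) (H : (ι → α) → ℝ) :
    ∑ x : ι → α, (∏ t, q (x t)) * H x =
      ∑ x : ι → α, (∏ t, q (x t)) * ∑ y, q y * H (Function.update x m y) := by
  classical
  -- Exchanging the coordinate m with an independent fresh draw is an involution that preserves the
  -- product weight.
  have hinv : Function.Involutive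
      (fun xy : (ι → α) × α => (Function.update xy.1 m xy.2, xy.1 m)) := fun xy => by simp
  have hprod : ∀ (x : ι → α) (y : α),
      (∏ t, q (Function.update x m y t)) * q (x m) = (∏ t, q (x t)) * q y := by
    intro x y
    rw [← Finset.mul_prod_erase Finset.univ (fun t => q (Function.update x m y t))
      (Finset.mem_univ m), ← Finset.mul_prod_erase Finset.univ (fun t => q (x t))
      (Finset.mem_univ m), Function.update_self]
    have : ∏ t ∈ Finset.univ.erase m, q (Function.update x m y t) =
        ∏ t ∈ Finset.univ.erase m, q (x t) :=
      Finset.prod_congr rfl fun t ht => by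
        rw [Function.update_of_ne (Finset.ne_of_mem_erase ht)]
    rw [this]
    ring
  calc ∑ x : ι → α, (∏ t, q (x t)) * H x
      = ∑ xy : (ι → α) × α, (∏ t, q (xy.1 t)) * q xy.2 * H xy.1 := by
        rw [Fintype.sum_prod_type]
        refine Finset.sum_congr rfl fun x _ => ?_
        simp only
        rw [← Finset.sum_mul, ← Finset.mul_sum, hq, mul_one]
    _ = ∑ xy : (ι → α) × α, (∏ t, q (xy.1 t)) * q xy.2 * H (Function.update xy.1 m xy.2) := by
        rw [← Equiv.sum_comp hinv.toPerm]
        refine Finset.sum_congr rfl fun xy _ => ?_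
        simp only [Function.Involutive.coe_toPerm, hprod]
    _ = _ := by
        rw [Fintype.sum_prod_type]
        refine Finset.sum_congr rfl fun x _ => ?_
        rw [Finset.mul_sum]
        exact Finset.sum_congr rfl fun y _ => by ring

/-- Hoeffding's lemma for a finitely supported distribution. -/
lemma sum_mul_exp_le_of_abs_le {q : α → ℝ} (hq0 : ∀ a, 0 ≤ q a) (hq : ∑ a, q a = 1) {c : ℝ}
    (hc : 0 < c) {f : α → ℝ} (hf : ∀ a, |f a| ≤ c) (hmean : ∑ a, q a * f a = 0) (θ : ℝ) :
    ∑ a, q a * Real.exp (θ * f a) ≤ Real.exp ((θ * c) ^ 2 / 2) := by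
  have h : ∀ a, Real.exp (θ * f a) ≤ Real.cosh (θ * c) + f a / c * Real.sinh (θ * c) := by
    intro a
    have h1 : |f a / c| ≤ 1 := by
      rw [abs_div, abs_of_pos hc, div_le_one hc]; exact hf a
    have h2 := Real.exp_mul_le_cosh_add_mul_sinh h1 (θ * c)
    have h3 : f a / c * (θ * c) = θ * f a := by field_simp
    rwa [h3] at h2
  calc ∑ a, q a * Real.exp (θ * f a)
      ≤ ∑ a, q a * (Real.cosh (θ * c) + f a / c * Real.sinh (θ * c)) :=
        Finset.sum_le_sum fun a _ => mul_le_mul_of_nonneg_left (h a) (hq0 a)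
    _ = (∑ a, q a) * Real.cosh (θ * c) + (∑ a, q a * f a) * (Real.sinh (θ * c) / c) := by
        rw [Finset.sum_mul, Finset.sum_mul, ← Finset.sum_add_distrib]
        exact Finset.sum_congr rfl fun a _ => by ring
    _ = Real.cosh (θ * c) := by rw [hq, hmean]; ring
    _ ≤ _ := Real.cosh_le_exp_half_sq _

/-- `hadapt` and `hmean` state the martingale difference property without filtrations: `M t` ignores
the samples after t, and averaging over the sample t alone gives zero. Rounds are added one at a
time; resampling the newest coordinate leaves the earlier increments fixed, and Hoeffding's lemma
bounds the new factor. -/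
lemma sum_prod_mul_exp_le {T : ℕ} {q : α → ℝ} (hq0 : ∀ a, 0 ≤ q a) (hq : ∑ a, q a = 1) {c : ℝ}
    (hc : 0 < c) {M : Fin T → (Fin T → α) → ℝ} (hM : ∀ t x, |M t x| ≤ c)
    (hadapt : ∀ t s, t < s → ∀ x y, M t (Function.update x s y) = M t x)
    (hmean : ∀ t x, ∑ y, q y * M t (Function.update x t y) = 0) (θ : ℝ) :
    ∑ x : Fin T → α, (∏ t, q (x t)) * Real.exp (θ * ∑ t, M t x) ≤
      Real.exp (T * ((θ * c) ^ 2 / 2)) := by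
  have key : ∀ m : ℕ, m ≤ T → ∑ x : Fin T → α, (∏ t, q (x t)) *
      Real.exp (θ * ∑ t with t.val < m, M t x) ≤ Real.exp (m * ((θ * c) ^ 2 / 2)) := by
    intro m
    induction m with
    | zero =>
      intro _
      have h1 : ∑ x : Fin T → α, ∏ t, q (x t) = 1 := by
        rw [← Fintype.prod_sum (fun (_ : Fin T) a => q a)]
        simp [hq]
      simp [h1]
    | succ m ih =>
      intro hm
      set s : Fin T := ⟨m, hm⟩ with hs
      have hfilter : (Finset.univ.filter fun t : Fin T => t.val < m + 1) =
          insert s (Finset.univ.filter fun t : Fin T => t.val < m) := by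
        ext t
        simp only [Finset.mem_filter, Finset.mem_univ, true_and, Finset.mem_insert, hs, Fin.ext_iff]
        omega
      have hnot : s ∉ Finset.univ.filter fun t : Fin T => t.val < m := by simp [hs]
      have hsplit : ∀ x, Real.exp (θ * ∑ t with t.val < m + 1, M t x) =
          Real.exp (θ * ∑ t with t.val < m, M t x) * Real.exp (θ * M s x) := by
        intro x
        rw [hfilter, Finset.sum_insert hnot, ← Real.exp_add]
        ring_nf
      have hpast : ∀ x y, ∑ t with t.val < m, M t (Function.update x s y) =
          ∑ t with t.val < m, M t x := fun x y =>
        Finset.sum_congr rfl fun t ht => hadapt t s (by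
          simpa [hs, Fin.lt_def] using ht) x y
      simp only [hsplit]
      rw [sum_prod_mul_eq_resample hq s]
      have hone : ∀ x, ∑ y, q y * (Real.exp (θ * ∑ t with t.val < m,
          M t (Function.update x s y)) * Real.exp (θ * M s (Function.update x s y))) ≤
          Real.exp (θ * ∑ t with t.val < m, M t x) * Real.exp ((θ * c) ^ 2 / 2) := by
        intro x
        have h2 := sum_mul_exp_le_of_abs_le hq0 hq hc (f := fun y => M s (Function.update x s y))
          (fun y => hM _ _) (hmean s x) θ
        refine le_trans (le_of_eq ?_) (mul_le_mul_of_nonneg_left h2 (Real.exp_pos _).le)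
        rw [Finset.mul_sum]
        refine Finset.sum_congr rfl fun y _ => ?_
        rw [hpast]
        ring
      calc _ ≤ ∑ x : Fin T → α, (∏ t, q (x t)) *
            (Real.exp (θ * ∑ t with t.val < m, M t x) * Real.exp ((θ * c) ^ 2 / 2)) :=
            Finset.sum_le_sum fun x _ => mul_le_mul_of_nonneg_left (hone x)
              (Finset.prod_nonneg fun t _ => hq0 _)
        _ = (∑ x : Fin T → α, (∏ t, q (x t)) * Real.exp (θ * ∑ t with t.val < m, M t x)) *
            Real.exp ((θ * c) ^ 2 / 2) := by
            rw [Finset.sum_mul]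
            exact Finset.sum_congr rfl fun x _ => by ring
        _ ≤ Real.exp (m * ((θ * c) ^ 2 / 2)) * Real.exp ((θ * c) ^ 2 / 2) :=
            mul_le_mul_of_nonneg_right (ih (by omega)) (Real.exp_pos _).le
        _ = _ := by
            rw [← Real.exp_add]
            push_cast
            ring_nf
  have h := key T le_rfl
  simpa using h

theorem azuma_finite {T : ℕ} (hT : 0 < T) {q : α → ℝ} (hq0 : ∀ a, 0 ≤ q a) (hq : ∑ a, q a = 1)
    {c : ℝ} (hc : 0 < c) {M : Fin T → (Fin T → α) → ℝ} (hM : ∀ t x, |M t x| ≤ c)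
    (hadapt : ∀ t s, t < s → ∀ x y, M t (Function.update x s y) = M t x)
    (hmean : ∀ t x, ∑ y, q y * M t (Function.update x t y) = 0) {l : ℝ} (hl : 0 ≤ l) :
    ∑ x : Fin T → α with c * √(2 * l * T) < ∑ t, M t x, ∏ t, q (x t) ≤ Real.exp (-l) := by
  have hT' : (0 : ℝ) < T := Nat.cast_pos.mpr hT
  set s := √(2 * l * T) with hs
  have hs2 : s ^ 2 = 2 * l * T := Real.sq_sqrt (by positivity)
  have hs0 : 0 ≤ s := Real.sqrt_nonneg _
  -- The optimal Chernoff parameter: the moment bound becomes exp(l), and θ times the threshold is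
  -- 2l.
  set θ := s / (c * T) with hθ
  have hθ0 : 0 ≤ θ := by positivity
  have h := sum_prod_mul_exp_le hq0 hq hc hM hadapt hmean θ
  have h1 : T * ((θ * c) ^ 2 / 2) = l := by
    rw [hθ]
    field_simp
    linarith
  have h2 : θ * (c * s) = 2 * l := by
    rw [hθ]
    field_simp
    linarith
  rw [h1] at h
  have h3 : Real.exp (2 * l) * ∑ x : Fin T → α with c * s < ∑ t, M t x, ∏ t, q (x t) ≤
      Real.exp l := by
    refine le_trans ?_ h
    rw [Finset.mul_sum]
    calc _ ≤ ∑ x : Fin T → α with c * s < ∑ t, M t x,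
          (∏ t, q (x t)) * Real.exp (θ * ∑ t, M t x) := by
          refine Finset.sum_le_sum fun x hx => ?_
          rw [mul_comm]
          refine mul_le_mul_of_nonneg_left (Real.exp_le_exp.mpr ?_)
            (Finset.prod_nonneg fun t _ => hq0 _)
          rw [← h2]
          exact mul_le_mul_of_nonneg_left (Finset.mem_filter.mp hx).2.le hθ0
      _ ≤ _ := Finset.sum_le_sum_of_subset_of_nonneg (Finset.filter_subset _ _) fun x _ _ =>
          mul_nonneg (Finset.prod_nonneg fun t _ => hq0 _) (Real.exp_pos _).le
  have h4 : Real.exp l = Real.exp (2 * l) * Real.exp (-l) := by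
    rw [← Real.exp_add]; ring_nf
  rw [h4] at h3
  exact le_of_mul_le_mul_left h3 (Real.exp_pos _)

end Azuma

/-! ### The law of the samples -/

/-- The σ-algebra on units is pulled back from ℤ. With measurable singletons, every subset of the
finite space `Config n` is measurable and laws reduce to mass functions. -/
instance : MeasurableSingletonClass ℤˣ where
  measurableSet_singleton s :=
    ⟨{(s : ℤ)}, MeasurableSet.of_discrete, by ext t; simp [Units.ext_iff]⟩

instance (q : ℝ) : IsFiniteMeasure (rad q) := ⟨by simp [rad]⟩

lemma rad_singleton (q : ℝ) (s : ℤˣ) : rad (1 - q) {s} = ENNReal.ofReal (radMass q s) := by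
  rcases Int.units_eq_one_or s with rfl | rfl <;> simp [rad, radMass]

lemma flipped_singleton {n : ℕ} (A : Matrix (Fin n) (Fin n) ℝ) {p : Fin n → ℝ}
    (h0 : ∀ i, 0 ≤ p i) (h1 : ∀ i, p i ≤ 1) (x : Config n) :
    flipped A 0 p {x} = ENNReal.ofReal (flippedMass A p x) := by
  have hpre : ∀ z : Config n, Prod.mk z ⁻¹'
      ((fun (zc : Config n × Config n) i => zc.2 i * zc.1 i) ⁻¹' {x}) =
      {fun i => x i * z i} := by
    intro z
    ext c
    simp only [Set.mem_preimage, Set.mem_singleton_iff, funext_iff]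
    refine forall_congr' fun i => ⟨fun h => ?_, fun h => ?_⟩
    · rw [← h, mul_assoc, Int.units_mul_self, mul_one]
    · rw [h, mul_assoc, Int.units_mul_self, mul_one]
  unfold flipped
  rw [Measure.map_apply Measurable.of_discrete MeasurableSet.of_discrete,
    Measure.prod_apply MeasurableSet.of_discrete]
  simp only [hpre, Measure.pi_singleton, rad_singleton]
  unfold ising
  rw [lintegral_finsetSum_measure]
  simp only [lintegral_smul_measure, lintegral_dirac, smul_eq_mul]
  unfold flippedMass
  rw [ENNReal.ofReal_sum_of_nonneg fun z _ => mul_nonneg (isingProb_pos A z).le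
    (Finset.prod_nonneg fun i _ => radMass_nonneg (h0 i) (h1 i) _)]
  refine Finset.sum_congr rfl fun z _ => ?_
  rw [ENNReal.ofReal_mul (isingProb_pos A z).le,
    ENNReal.ofReal_prod_of_nonneg fun i _ => radMass_nonneg (h0 i) (h1 i) _]
  rfl

/-- An event of small mass under the product of the flipped distributions is unlikely for
independent flipped samples. -/
lemma one_sub_le_measureReal {n T : ℕ} (A : Matrix (Fin n) (Fin n) ℝ) {p : Fin n → ℝ}
    (h0 : ∀ i, 0 ≤ p i) (h1 : ∀ i, p i ≤ 1) {Ω : Type*} [MeasurableSpace Ω] (P : Measure Ω)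
    [IsProbabilityMeasure P] (X : Fin T → Ω → Config n)
    (hX : ∀ t, HasLaw (X t) (flipped A 0 p) P) (hind : iIndepFun X P)
    (Bad : Finset (Fin T → Config n)) {δ : ℝ}
    (hBad : ∑ x ∈ Bad, ∏ t, flippedMass A p (x t) ≤ δ) :
    1 - δ ≤ P.real {ω | (fun t => X t ω) ∉ Bad} := by
  have hlaw := (iIndepFun_iff_map_fun_eq_pi_map fun t => (hX t).aemeasurable).mp hind
  simp only [(hX _).map_eq] at hlaw
  have hprob : IsProbabilityMeasure (flipped A 0 p) := by
    refine ⟨?_⟩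
    have h := sum_measure_singleton (μ := flipped A 0 p) (s := Finset.univ)
    simp only [flipped_singleton A h0 h1] at h
    rw [← ENNReal.ofReal_sum_of_nonneg fun x _ => flippedMass_nonneg A h0 h1 x,
      sum_flippedMass] at h
    simpa using h.symm
  have hae : AEMeasurable (fun ω t => X t ω) P := aemeasurable_pi_lambda _ fun t =>
    (hX t).aemeasurable
  have hb : P.real {ω | (fun t => X t ω) ∈ Bad} ≤ δ := by
    have e1 : P {ω | (fun t => X t ω) ∈ Bad} =
        ENNReal.ofReal (∑ x ∈ Bad, ∏ t, flippedMass A p (x t)) := by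
      have h2 := Measure.map_apply_of_aemeasurable hae
        (MeasurableSet.of_discrete (s := (Bad : Set (Fin T → Config n))))
      rw [hlaw] at h2
      have h3 : {ω | (fun t => X t ω) ∈ Bad} =
        (fun ω t => X t ω) ⁻¹' (Bad : Set (Fin T → Config n)) := rfl
      rw [h3, ← h2, ← sum_measure_singleton, ENNReal.ofReal_sum_of_nonneg fun x _ =>
        Finset.prod_nonneg fun t _ => flippedMass_nonneg A h0 h1 _]
      refine Finset.sum_congr rfl fun x _ => ?_
      rw [Measure.pi_singleton, ENNReal.ofReal_prod_of_nonneg fun t _ =>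
        flippedMass_nonneg A h0 h1 _]
      exact Finset.prod_congr rfl fun t _ => flipped_singleton A h0 h1 _
    rw [measureReal_def, e1, ENNReal.toReal_ofReal (Finset.sum_nonneg fun x _ =>
        Finset.prod_nonneg fun t _ => flippedMass_nonneg A h0 h1 _)]
    exact hBad
  have hu : (1 : ℝ) ≤ P.real {ω | (fun t => X t ω) ∉ Bad} +
      P.real {ω | (fun t => X t ω) ∈ Bad} := by
    have h := measureReal_union_le (μ := P) {ω | (fun t => X t ω) ∉ Bad}
      {ω | (fun t => X t ω) ∈ Bad}
    have e : {ω | (fun t => X t ω) ∉ Bad} ∪ {ω | (fun t => X t ω) ∈ Bad} = Set.univ := by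
      ext ω; simp [em']
    rwa [e, probReal_univ] at h
  linarith

/-! ### The martingale of gradient noise -/

/-- The iterate at index t has consumed only the samples with index below t; this makes the noise
adapted and the current sample independent of the current iterate. -/
lemma smgIter_congr {k T : ℕ} (p : Fin (k + 1) → ℝ) (lam η : ℝ) {x x' : Fin T → Config (k + 1)}
    {t : ℕ} (h : ∀ s : Fin T, s.val < t → x s = x' s) :
    smgIter p lam η x t = smgIter p lam η x' t := by
  induction t with
  | zero => rfl
  | succ t ih =>
    have ih' := ih fun s hs => h s (by omega)
    rw [smgIter, smgIter, ih']
    split_ifs with ht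
    · rw [h ⟨t, ht⟩ (Nat.lt_succ_self t)]
    · rfl

lemma smgIter_update {k T : ℕ} (p : Fin (k + 1) → ℝ) (lam η : ℝ) (x : Fin T → Config (k + 1))
    {t s : Fin T} (h : t ≤ s) (y : Config (k + 1)) :
    smgIter p lam η (Function.update x s y) t = smgIter p lam η x t :=
  smgIter_congr p lam η fun r hr => by
    rw [Function.update_of_ne]
    rintro rfl
    exact absurd hr (not_lt.mpr h)

/-- The contribution of round `t` to the difference between the true and the estimated regret. -/
noncomputable def noise {k T : ℕ} (A : Matrix (Fin (k + 1)) (Fin (k + 1)) ℝ)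
    (p : Fin (k + 1) → ℝ) (lam η : ℝ) (t : Fin T) (x : Fin T → Config (k + 1)) : ℝ :=
  ∑ i, (toBall (smgIter p lam η x t) i - lastRow A i) *
    (screenGrad A (toBall (smgIter p lam η x t)) i - gFlip p i (smgIter p lam η x t) (x t))

lemma noise_update_of_lt {k T : ℕ} (A : Matrix (Fin (k + 1)) (Fin (k + 1)) ℝ)
    (p : Fin (k + 1) → ℝ) (lam η : ℝ) {t s : Fin T} (h : t < s) (x : Fin T → Config (k + 1))
    (y : Config (k + 1)) :
    noise A p lam η t (Function.update x s y) = noise A p lam η t x := by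
  unfold noise
  rw [smgIter_update p lam η x h.le, Function.update_of_ne h.ne]

lemma sum_flippedMass_noise {k T : ℕ} (A : Matrix (Fin (k + 1)) (Fin (k + 1)) ℝ)
    {p : Fin (k + 1) → ℝ} (hp : ∀ i, 1 - 2 * p i ≠ 0) (lam η : ℝ) (t : Fin T)
    (x : Fin T → Config (k + 1)) :
    ∑ y, flippedMass A p y * noise A p lam η t (Function.update x t y) = 0 := by
  simp only [noise, smgIter_update p lam η x le_rfl, Function.update_self]
  set w := smgIter p lam η x t
  simp only [Finset.mul_sum]
  rw [Finset.sum_comm]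
  refine Finset.sum_eq_zero fun i _ => ?_
  have h : ∀ y, flippedMass A p y * ((toBall w i - lastRow A i) *
      (screenGrad A (toBall w) i - gFlip p i w y)) = (toBall w i - lastRow A i) *
      (flippedMass A p y * screenGrad A (toBall w) i - flippedMass A p y * gFlip p i w y) :=
    fun y => by ring
  rw [Finset.sum_congr rfl fun y _ => h y, ← Finset.mul_sum, Finset.sum_sub_distrib,
    ← Finset.sum_mul, sum_flippedMass, sum_flippedMass_gFlip A hp]
  ring

lemma abs_screenGrad_le {k : ℕ} (A : Matrix (Fin (k + 1)) (Fin (k + 1)) ℝ)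
    {p : Fin (k + 1) → ℝ} (hp0 : ∀ i, 0 ≤ p i) (hp1 : ∀ i, 0 < 1 - 2 * p i) {B : ℝ}
    {w : Coord k → ℝ} {i : Fin k} (hg : ∀ x, |gFlip p i w x| ≤ B) :
    |screenGrad A (toBall w) i| ≤ B := by
  have hq := flippedMass_nonneg A hp0 fun i => by linarith [hp0 i, hp1 i]
  rw [← sum_flippedMass_gFlip A (fun i => (hp1 i).ne') w i]
  calc _ ≤ ∑ x, |flippedMass A p x * gFlip p i w x| := Finset.abs_sum_le_sum_abs _ _
    _ ≤ ∑ x, flippedMass A p x * B := Finset.sum_le_sum fun x _ => by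
        rw [abs_mul, abs_of_nonneg (hq x)]
        exact mul_le_mul_of_nonneg_left (hg x) (hq x)
    _ = B := by rw [← Finset.sum_mul, sum_flippedMass, one_mul]

/-- Hölder: the iterate and the true row have ℓ¹ norm at most lam each, and the true and estimated
gradients are both at most B in absolute value. -/
lemma abs_noise_le {k T : ℕ} {A : Matrix (Fin (k + 1)) (Fin (k + 1)) ℝ}
    {p : Fin (k + 1) → ℝ} (hp0 : ∀ i, 0 ≤ p i) (hp1 : ∀ i, 0 < 1 - 2 * p i) {lam η B : ℝ}
    (hB : 0 ≤ B) (hg : ∀ (w : Coord k → ℝ), InSimplex lam w → ∀ x i, |gFlip p i w x| ≤ B)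
    (hw : ∀ (x : Fin T → Config (k + 1)) t, InSimplex lam (smgIter p lam η x t))
    (hrow : ∑ i, |lastRow A i| ≤ lam) (t : Fin T) (x : Fin T → Config (k + 1)) :
    |noise A p lam η t x| ≤ 4 * lam * B := by
  have hwt := hw x t
  unfold noise
  set w := smgIter p lam η x t
  calc _ ≤ ∑ i, |(toBall w i - lastRow A i) * (screenGrad A (toBall w) i - gFlip p i w (x t))| :=
        Finset.abs_sum_le_sum_abs _ _
    _ ≤ ∑ i, (|toBall w i| + |lastRow A i|) * (2 * B) := by
        refine Finset.sum_le_sum fun i _ => ?_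
        rw [abs_mul]
        refine mul_le_mul (abs_sub _ _) ?_ (abs_nonneg _) (by positivity)
        have h1 := abs_screenGrad_le A hp0 hp1 fun x => hg w hwt x i
        have h2 := hg w hwt (x t) i
        have h3 := abs_sub (screenGrad A (toBall w) i) (gFlip p i w (x t))
        linarith
    _ = ((∑ i, |toBall w i|) + ∑ i, |lastRow A i|) * (2 * B) := by
        rw [← Finset.sum_mul, Finset.sum_add_distrib]
    _ ≤ (lam + lam) * (2 * B) := by
        gcongr
        exact hwt.sum_abs_toBall_le
    _ = _ := by ring

/-! ### From regret to the estimation error -/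

lemma toBall_smgOutput {k T : ℕ} (p : Fin (k + 1) → ℝ) (lam η : ℝ)
    (x : Fin T → Config (k + 1)) (i : Fin k) :
    toBall (smgOutput p lam η x) i =
      (1 / (T : ℝ)) * ∑ t : Fin T, toBall (smgIter p lam η x t) i := by
  simp only [toBall, smgOutput]
  rw [← mul_sub, ← Finset.sum_sub_distrib,
    Finset.sum_range (fun t => smgIter p lam η x t (Sum.inl i) -
      smgIter p lam η x t (Sum.inr (Sum.inl i)))]

lemma abs_toBall_smgOutput_le {k T : ℕ} (hT : 0 < T) {p : Fin (k + 1) → ℝ} {lam η : ℝ}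
    {x : Fin T → Config (k + 1)} (hw : ∀ t, InSimplex lam (smgIter p lam η x t)) (i : Fin k) :
    |toBall (smgOutput p lam η x) i| ≤ lam := by
  have hT' : (0 : ℝ) < T := Nat.cast_pos.mpr hT
  rw [toBall_smgOutput, abs_mul, abs_of_pos (one_div_pos.mpr hT'), one_div, inv_mul_le_iff₀ hT']
  calc _ ≤ ∑ t : Fin T, |toBall (smgIter p lam η x t) i| := Finset.abs_sum_le_sum_abs _ _
    _ ≤ ∑ _t : Fin T, lam := Finset.sum_le_sum fun t _ =>
        (Finset.single_le_sum (f := fun j => |toBall (smgIter p lam η x t) j|)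
          (fun _ _ => abs_nonneg _) (Finset.mem_univ i)).trans (hw t).sum_abs_toBall_le
    _ = T * lam := by simp

/-- At each iterate, quadratic growth and convexity bound the squared error of coordinate i by 2
exp(5 lam) times the linearized excess. Summed over the rounds, that excess is the estimated regret
plus the noise, neither of which depends on i. -/
theorem sq_error_le {k T : ℕ} (hT : 0 < T) {A : Matrix (Fin (k + 1)) (Fin (k + 1)) ℝ}
    (hA : A.IsSymm) (hd : ∀ i, A i i = 0) {p : Fin (k + 1) → ℝ} {lam η B : ℝ} (hlam : 0 < lam)
    (hη : 0 < η) (hB : 0 ≤ B) (hηB : 4 * (η * B) ≤ 1)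
    (hg : ∀ (w : Coord k → ℝ), InSimplex lam w → ∀ x i, |gFlip p i w x| ≤ B)
    (hrows : ∀ i, ∑ j, |A i j| ≤ lam) (hrow : ∑ i, |lastRow A i| ≤ lam)
    (x : Fin T → Config (k + 1)) (i : Fin k) :
    T * (toBall (smgOutput p lam η x) i - lastRow A i) ^ 2 ≤ 2 * Real.exp (5 * lam) *
      ((lam * Real.log (2 * k + 1) + T * (8 * lam * η ^ 2 * B ^ 2)) / η +
        ∑ t, noise A p lam η t x) := by
  have hT' : (0 : ℝ) < T := Nat.cast_pos.mpr hT
  have hreg := regret_le hlam hη hB hηB hg x hrow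
  set w : Fin T → Coord k → ℝ := fun t => smgIter p lam η x t
  set e : Fin T → ℝ := fun t => toBall (w t) i - lastRow A i
  have h1 : toBall (smgOutput p lam η x) i - lastRow A i = (1 / (T : ℝ)) * ∑ t, e t := by
    rw [toBall_smgOutput, Finset.sum_sub_distrib, mul_sub]
    simp only [Finset.sum_const, Finset.card_univ, Fintype.card_fin, nsmul_eq_mul]
    field_simp
    rfl
  -- Cauchy–Schwarz passes from the individual iterates to their average.
  have h2 : T * (toBall (smgOutput p lam η x) i - lastRow A i) ^ 2 ≤ ∑ t, e t ^ 2 := by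
    have hcs := sq_sum_le_card_mul_sum_sq (s := Finset.univ) (f := e)
    rw [Finset.card_univ, Fintype.card_fin] at hcs
    rw [h1]
    have : (T : ℝ) * (1 / (T : ℝ) * ∑ t, e t) ^ 2 = (∑ t, e t) ^ 2 / T := by field_simp
    rw [this, div_le_iff₀ hT', mul_comm]
    exact hcs
  have h3 : ∀ t, e t ^ 2 ≤ 2 * Real.exp (5 * lam) *
      ∑ j, (toBall (w t) j - lastRow A j) * screenGrad A (toBall (w t)) j := by
    intro t
    have hg1 := screen_sub_screen_lastRow_ge hA hd hrows (toBall (w t)) i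
    have hg2 := hg1.trans (screen_sub_le A (lastRow A) (toBall (w t)))
    rw [Real.exp_neg] at hg2
    have hE := Real.exp_pos (5 * lam)
    have := mul_le_mul_of_nonneg_left hg2 (by positivity : 0 ≤ 2 * Real.exp (5 * lam))
    refine le_trans (le_of_eq ?_) this
    field_simp
    rfl
  have h4 : ∑ t, ∑ j, (toBall (w t) j - lastRow A j) * screenGrad A (toBall (w t)) j =
      (∑ t, ∑ j, (toBall (w t) j - lastRow A j) * gFlip p j (w t) (x t)) +
        ∑ t, noise A p lam η t x := by
    rw [← Finset.sum_add_distrib]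
    refine Finset.sum_congr rfl fun t _ => ?_
    unfold noise
    rw [← Finset.sum_add_distrib]
    exact Finset.sum_congr rfl fun j _ => by ring
  have h5 : ∑ t, ∑ j, (toBall (w t) j - lastRow A j) * gFlip p j (w t) (x t) ≤
      (lam * Real.log (2 * k + 1) + T * (8 * lam * η ^ 2 * B ^ 2)) / η := by
    rw [le_div_iff₀ hη, mul_comm]
    exact hreg
  calc _ ≤ ∑ t, e t ^ 2 := h2
    _ ≤ ∑ t, 2 * Real.exp (5 * lam) *
        ∑ j, (toBall (w t) j - lastRow A j) * screenGrad A (toBall (w t)) j :=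
        Finset.sum_le_sum fun t _ => h3 t
    _ = 2 * Real.exp (5 * lam) * ((∑ t, ∑ j, (toBall (w t) j - lastRow A j) *
        gFlip p j (w t) (x t)) + ∑ t, noise A p lam η t x) := by rw [← Finset.mul_sum, h4]
    _ ≤ _ := by gcongr

/-! ### Choice of the parameters -/

lemma sum_abs_le_of_width_le {n : ℕ} {A : Matrix (Fin n) (Fin n) ℝ} {lam : ℝ}
    (h : width A 0 ≤ lam) (i : Fin n) : ∑ j, |A i j| ≤ lam := by
  have := le_ciSup (f := fun i => (∑ j, |A i j|) + |(0 : Fin n → ℝ) i|)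
    (Set.finite_range _).bddAbove i
  simp only [Pi.zero_apply, abs_zero, add_zero] at this
  refine this.trans ?_
  simpa [width] using h

lemma sum_abs_lastRow_le {k : ℕ} {A : Matrix (Fin (k + 1)) (Fin (k + 1)) ℝ} {lam : ℝ}
    (h : ∑ j, |A (Fin.last k) j| ≤ lam) : ∑ i, |lastRow A i| ≤ lam := by
  rw [Fin.sum_univ_castSucc] at h
  have := abs_nonneg (A (Fin.last k) (Fin.last k))
  simp only [lastRow]
  linarith

/-- The bound on the regret for the step size `√(L / T) / (2 B)`. -/
lemma regret_bound_le {lam L L' B T : ℝ} (hlam : 0 < lam) (hL : 0 < L) (hL' : L' ≤ L)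
    (hB : 0 < B) (hT : 0 < T) :
    (lam * L' + T * (8 * lam * (√(L / T) / (2 * B)) ^ 2 * B ^ 2)) / (√(L / T) / (2 * B)) ≤
      6 * lam * B * √(L * T) := by
  have hs : 0 < √(L / T) := Real.sqrt_pos.mpr (div_pos hL hT)
  have hs2 : √(L / T) ^ 2 = L / T := Real.sq_sqrt (div_pos hL hT).le
  have hLT : √(L * T) = T * √(L / T) := by
    have : L * T = (T * √(L / T)) ^ 2 := by
      rw [mul_pow, hs2]
      field_simp
    rw [this, Real.sqrt_sq (by positivity)]
  rw [div_le_iff₀ (by positivity), hLT]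
  have e1 : T * (8 * lam * (√(L / T) / (2 * B)) ^ 2 * B ^ 2) = 2 * (lam * L) := by
    rw [div_pow, hs2]
    field_simp
    ring
  have e2 : 6 * lam * B * (T * √(L / T)) * (√(L / T) / (2 * B)) = 3 * (lam * L) := by
    have : 6 * lam * B * (T * √(L / T)) * (√(L / T) / (2 * B)) =
        3 * lam * T * √(L / T) ^ 2 := by field_simp; ring
    rw [this, hs2]
    field_simp
  rw [e1, e2]
  nlinarith

/-- The sample-size condition gives √(2ℓT) lam² exp K ≤ 2Tε² after taking square roots, and `hK`
trades 40 E B for lam exp K. This trade is how a power lam⁴ in the sample size serves for an error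
bound with a single factor lam. -/
lemma error_bound {lam K B T ℓ ε E : ℝ} (hlam : 0 < lam) (hT : 0 < T) (hℓ : 0 < ℓ)
    (hK : 40 * E * B ≤ lam * Real.exp K)
    (h : lam ^ 4 * ℓ * Real.exp (2 * K) ≤ T * ε ^ 4) :
    2 * E * (10 * lam * B * √(2 * ℓ * T)) ≤ T * ε ^ 2 := by
  set Q := √(2 * ℓ * T) with hQ
  have hQ0 : 0 ≤ Q := Real.sqrt_nonneg _
  have hQ2 : Q ^ 2 = 2 * ℓ * T := Real.sq_sqrt (by positivity)
  have hexp : Real.exp (2 * K) = Real.exp K ^ 2 := by rw [← Real.exp_nat_mul]; norm_num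
  have h1 : Q * (lam ^ 2 * Real.exp K) ≤ 2 * T * ε ^ 2 := by
    refine le_of_sq_le_sq ?_ (by positivity)
    calc (Q * (lam ^ 2 * Real.exp K)) ^ 2 = 2 * T * (lam ^ 4 * ℓ * Real.exp (2 * K)) := by
          rw [mul_pow, hQ2, hexp]; ring
      _ ≤ 2 * T * (T * ε ^ 4) := by gcongr
      _ ≤ (2 * T * ε ^ 2) ^ 2 := by nlinarith [sq_nonneg (T * ε ^ 2)]
  have h2 : 40 * E * B * (lam * Q) ≤ lam * Real.exp K * (lam * Q) :=
    mul_le_mul_of_nonneg_right hK (by positivity)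
  nlinarith

theorem smgOutput_accuracy {k T : ℕ} (hk : 1 ≤ k) (hT : 0 < T)
    {A : Matrix (Fin (k + 1)) (Fin (k + 1)) ℝ} (hA : A.IsSymm) (hd : ∀ i, A i i = 0)
    {p : Fin (k + 1) → ℝ} (hp0 : ∀ i, 0 ≤ p i) (hp1 : ∀ i, 0 < 1 - 2 * p i)
    {lam B K ε δ : ℝ} (hlam : 0 < lam) (hB : 0 < B)
    (hg : ∀ (w : Coord k → ℝ), InSimplex lam w → ∀ x i, |gFlip p i w x| ≤ B)
    (hrows : ∀ i, ∑ j, |A i j| ≤ lam) (hε : 0 < ε) (hδ : 0 < δ) (hδ1 : δ < 1)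
    (hK : 40 * Real.exp (5 * lam) * B ≤ lam * Real.exp K) (hK' : 128 ≤ Real.exp (2 * K))
    (hTε : lam ^ 4 * Real.log (((k + 1 : ℕ) : ℝ) / δ) * Real.exp (2 * K) ≤ T * ε ^ 4)
    {Ω : Type*} [MeasurableSpace Ω] (P : Measure Ω) [IsProbabilityMeasure P]
    (X : Fin T → Ω → Config (k + 1)) (hX : ∀ t, HasLaw (X t) (flipped A 0 p) P)
    (hind : iIndepFun X P) :
    1 - δ ≤ P.real {ω | ∀ i : Fin k, |toBall (smgOutput p lam
      (min (1 / (4 * B)) (√(Real.log (2 * k + 2) / T) / (2 * B))) fun t => X t ω) i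
        - lastRow A i| ≤ ε} := by
  have hT' : (0 : ℝ) < T := Nat.cast_pos.mpr hT
  have hk' : (1 : ℝ) ≤ k := Nat.one_le_cast.mpr hk
  set L := Real.log (2 * k + 2) with hL
  set ℓ := Real.log (((k + 1 : ℕ) : ℝ) / δ) with hℓ
  set l := Real.log (1 / δ) with hl
  have hLpos : 0 < L := Real.log_pos (by linarith)
  have hlpos : 0 < l := Real.log_pos (by rw [lt_div_iff₀ hδ]; linarith)
  have hℓl : ℓ = Real.log (k + 1) + l := by
    rw [hℓ, hl, Real.log_div (by positivity) hδ.ne', Real.log_div one_ne_zero hδ.ne', Real.log_one]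
    push_cast
    ring
  have hlogk : 0 < Real.log ((k : ℝ) + 1) := Real.log_pos (by linarith)
  have hℓpos : 0 < ℓ := by linarith
  -- Uses 2k + 2 ≤ (k + 1)², which needs k ≥ 1.
  have hLℓ : L ≤ 2 * ℓ := by
    have h2 : L ≤ Real.log (((k : ℝ) + 1) ^ 2) := Real.log_le_log (by positivity) (by nlinarith)
    rw [Real.log_pow] at h2
    push_cast at h2
    linarith
  -- The second entry balances the regret; the cap ensures 4ηB ≤ 1 for every T, as the step size may
  -- not depend on ε or δ.
  set η := min (1 / (4 * B)) (√(L / T) / (2 * B)) with hη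
  have hηpos : 0 < η := lt_min (by positivity)
    (div_pos (Real.sqrt_pos.mpr (div_pos hLpos hT')) (by positivity))
  have hηB : 4 * (η * B) ≤ 1 := by
    have h1 : η ≤ 1 / (4 * B) := min_le_left _ _
    rw [le_div_iff₀ (by positivity)] at h1
    linarith
  have hw := fun x t => inSimplex_smgIter (T := T) hlam hηpos hB.le hηB hg x t
  have hrow := sum_abs_lastRow_le (hrows (Fin.last k))
  -- The output and the true couplings both lie in [-lam, lam], so ε ≥ 2 lam is trivial. For smaller
  -- ε the sample-size condition forces T to be large, and the cap on η is inactive.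
  rcases le_or_gt (2 * lam) ε with hbig | hsmall
  · have huniv : {ω | ∀ i : Fin k, |toBall (smgOutput p lam η fun t => X t ω) i
        - lastRow A i| ≤ ε} = Set.univ := by
      ext ω
      simp only [Set.mem_ofPred_eq, Set.mem_univ, iff_true]
      intro i
      have h1 := abs_toBall_smgOutput_le hT (hw fun t => X t ω) i
      have h2 := (Finset.single_le_sum (f := fun j => |lastRow A j|)
        (fun _ _ => abs_nonneg _) (Finset.mem_univ i)).trans hrow
      have h3 := abs_sub (toBall (smgOutput p lam η fun t => X t ω) i) (lastRow A i)
      linarith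
    rw [huniv, probReal_univ]
    linarith
  · have hηeq : η = √(L / T) / (2 * B) := by
      refine min_eq_right ?_
      -- From ε⁴ ≤ 16 lam⁴ and 128 ≤ exp(2K), as 128 / 16 = 8. Then L ≤ 2ℓ ≤ T/4.
      have h8 : 8 * ℓ ≤ T := by
        have h1 : ε ^ 4 ≤ (2 * lam) ^ 4 := by gcongr
        have h2 : lam ^ 4 * (ℓ * Real.exp (2 * K)) ≤ lam ^ 4 * (16 * T) := by
          calc _ = lam ^ 4 * ℓ * Real.exp (2 * K) := by ring
            _ ≤ T * ε ^ 4 := hTε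
            _ ≤ T * (2 * lam) ^ 4 := by gcongr
            _ = _ := by ring
        have h3 := le_of_mul_le_mul_left h2 (by positivity)
        nlinarith
      have hsq : √(L / T) ≤ 1 / 2 := by
        rw [Real.sqrt_le_left (by norm_num), div_le_iff₀ hT']
        linarith
      rw [div_le_div_iff₀ (by positivity) (by positivity)]
      nlinarith
    have hcpos : 0 < 4 * lam * B := by positivity
    have hp1' : ∀ i, p i ≤ 1 := fun i => by linarith [hp0 i, hp1 i]
    have haz := azuma_finite hT (flippedMass_nonneg A hp0 hp1') (sum_flippedMass A p) hcpos
      (abs_noise_le (A := A) hp0 hp1 hB.le hg hw hrow)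
      (fun t s h x y => noise_update_of_lt A p lam η h x y)
      (sum_flippedMass_noise A (fun i => (hp1 i).ne') lam η) hlpos.le
    have hδl : Real.exp (-l) = δ := by
      rw [hl, one_div, Real.log_inv, neg_neg, Real.exp_log hδ]
    rw [hδl] at haz
    refine (one_sub_le_measureReal A hp0 hp1' P X hX hind _ haz).trans
      (measureReal_mono fun ω hω i => ?_)
    simp only [Set.mem_ofPred_eq, Finset.mem_filter, Finset.mem_univ, true_and, not_lt] at hω
    have hsq := sq_error_le hT hA hd hlam hηpos hB.le hηB hg hrows hrow (fun t => X t ω) i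
    have hreg := regret_bound_le (L' := Real.log (2 * k + 1)) hlam hLpos
      (Real.log_le_log (by positivity) (by linarith)) hB hT'
    rw [← hηeq] at hreg
    have hs1 : √(L * T) ≤ √(2 * ℓ * T) := Real.sqrt_le_sqrt (by gcongr)
    have hs2 : √(2 * l * T) ≤ √(2 * ℓ * T) := Real.sqrt_le_sqrt (by gcongr; linarith)
    have htot : (lam * Real.log (2 * k + 1) + T * (8 * lam * η ^ 2 * B ^ 2)) / η +
        ∑ t, noise A p lam η t (fun t => X t ω) ≤ 10 * lam * B * √(2 * ℓ * T) := by
      have h1 : 6 * lam * B * √(L * T) ≤ 6 * lam * B * √(2 * ℓ * T) := by gcongr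
      have h2 : 4 * lam * B * √(2 * l * T) ≤ 4 * lam * B * √(2 * ℓ * T) := by gcongr
      linarith
    have hfin := (hsq.trans (mul_le_mul_of_nonneg_left htot (by positivity))).trans
      (error_bound hlam hT' hℓpos hK hTε)
    exact abs_le_of_sq_le_sq (le_of_mul_le_mul_left hfin hT') hε.le

end FlipIsing

open FlipIsing

theorem mainTheorem2
    (pmax : ℝ) (hpmax : pmax < 1 / 2) (lam₀ : ℝ) (hlam₀ : 0 < lam₀) :
    ∃ C : ℝ, 0 < C ∧
      ∀ (k : ℕ) (p : Fin (k + 1) → ℝ), (∀ i, 0 ≤ p i ∧ p i ≤ pmax) →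
      ∀ lam : ℝ, lam₀ ≤ lam →
      ∀ T : ℕ, ∃ η : ℝ, 0 < η ∧
        ∀ ε δ : ℝ, 0 < ε → 0 < δ → δ < 1 →
        lam ^ 4 * Real.log (((k + 1 : ℕ) : ℝ) / δ) * Real.exp (C * lam) * ε⁻¹ ^ 4 ≤ (T : ℝ) →
        ∀ A : Matrix (Fin (k + 1)) (Fin (k + 1)) ℝ,
          A.IsSymm → (∀ i, A i i = 0) → FlipIsing.width A 0 ≤ lam →
        ∀ (Ω : Type*) [MeasurableSpace Ω] (P : Measure Ω) [IsProbabilityMeasure P]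
          (X : Fin T → Ω → FlipIsing.Config (k + 1)),
          (∀ t, HasLaw (X t) (FlipIsing.flipped A 0 p) P) → iIndepFun X P →
          1 - δ ≤ P.real {ω | ∀ i : Fin k,
            |FlipIsing.toBall (FlipIsing.smgOutput p lam η fun t => X t ω) i
              - A (Fin.last k) i.castSucc| ≤ ε} := by
  have hpm : 0 < 1 - 2 * pmax := by linarith
  set c := 1 / (1 - 2 * pmax) with hc
  have hc0 : 0 < c := one_div_pos.mpr hpm
  -- The first term gives 40 c² ≤ lam exp(D lam) for all lam ≥ lam₀, the second gives exp(2K) ≥ 128.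
  -- In the constant below, 5 comes from quadratic growth, c from B, and the doubling from squaring
  -- exp K.
  set D := 40 * c ^ 2 / lam₀ ^ 2 + 128 / lam₀ with hD
  refine ⟨2 * (5 + c + D), by positivity, fun k p hp lam hlam T => ?_⟩
  have hlam0 : 0 < lam := hlam₀.trans_le hlam
  have hp0 : ∀ i, 0 ≤ p i := fun i => (hp i).1
  have hp1 : ∀ i, 0 < 1 - 2 * p i := fun i => by linarith [(hp i).2]
  have hpc : ∀ i, 1 ≤ c * (1 - 2 * p i) := fun i => by
    rw [hc, one_div, ← div_eq_inv_mul, one_le_div hpm]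
    linarith [(hp i).2]
  set B := c ^ 2 * Real.exp (c * lam) with hB
  have hBpos : 0 < B := by positivity
  have hg : ∀ (w : Coord k → ℝ), InSimplex lam w → ∀ x i, |gFlip p i w x| ≤ B :=
    fun w hw x i => abs_gFlip_le hp0 hp1 hpc hc0.le i w hw.sum_abs_toBall_le x
  set K := (5 + c + D) * lam with hK
  have hDlam : 40 * c ^ 2 / lam₀ + 128 ≤ D * lam := by
    have h1 : 40 * c ^ 2 / lam₀ + 128 = D * lam₀ := by rw [hD]; field_simp
    rw [h1]
    gcongr
  have hKB : 40 * Real.exp (5 * lam) * B ≤ lam * Real.exp K := by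
    have h1 : Real.exp K = Real.exp (5 * lam) * Real.exp (c * lam) * Real.exp (D * lam) := by
      rw [← Real.exp_add, ← Real.exp_add, hK]; ring_nf
    have h2 : 40 * c ^ 2 ≤ lam * Real.exp (D * lam) := by
      have h3 := Real.add_one_le_exp (D * lam)
      calc 40 * c ^ 2 = lam₀ * (40 * c ^ 2 / lam₀) := by field_simp
        _ ≤ lam * Real.exp (D * lam) := by gcongr; linarith
    rw [h1, hB]
    calc _ = Real.exp (5 * lam) * Real.exp (c * lam) * (40 * c ^ 2) := by ring
      _ ≤ Real.exp (5 * lam) * Real.exp (c * lam) * (lam * Real.exp (D * lam)) := by gcongr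
      _ = _ := by ring
  have hK128 : 128 ≤ Real.exp (2 * K) := by
    have h1 := Real.add_one_le_exp (2 * K)
    have h2 : D * lam ≤ K := by
      rw [hK]
      nlinarith
    have h3 : 0 < 40 * c ^ 2 / lam₀ := by positivity
    linarith
  -- For T = 0 the sample-size condition fails, its left side being positive, so any step size will
  -- do.
  rcases Nat.eq_zero_or_pos T with rfl | hT
  · refine ⟨1, one_pos, fun ε δ hε hδ hδ1 hTε => ?_⟩
    have hlog : 0 < Real.log (((k + 1 : ℕ) : ℝ) / δ) := by
      refine Real.log_pos ?_
      rw [lt_div_iff₀ hδ]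
      push_cast
      have : (0 : ℝ) ≤ k := Nat.cast_nonneg k
      linarith
    have : 0 < lam ^ 4 * Real.log (((k + 1 : ℕ) : ℝ) / δ) *
        Real.exp (2 * (5 + c + D) * lam) * ε⁻¹ ^ 4 := by positivity
    rw [Nat.cast_zero] at hTε
    linarith
  · have hT' : (0 : ℝ) < T := Nat.cast_pos.mpr hT
    have hlogpos : 0 < Real.log (2 * (k : ℝ) + 2) := Real.log_pos (by
      have : (0 : ℝ) ≤ k := Nat.cast_nonneg k
      linarith)
    refine ⟨min (1 / (4 * B)) (√(Real.log (2 * k + 2) / T) / (2 * B)),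
      lt_min (by positivity) (by positivity), ?_⟩
    intro ε δ hε hδ hδ1 hTε A hA hd hwidth Ω _ P _ X hX hind
    -- With a single vertex there is no coupling to estimate.
    rcases Nat.eq_zero_or_pos k with rfl | hk
    · simp [hδ.le]
    · refine smgOutput_accuracy hk hT hA hd hp0 hp1 hlam0 hBpos hg
        (sum_abs_le_of_width_le hwidth) hε hδ hδ1 hKB hK128 ?_ P X hX hind
      rw [inv_pow, ← div_eq_mul_inv, div_le_iff₀ (by positivity)] at hTε
      have e : 2 * K = 2 * (5 + c + D) * lam := by rw [hK]; ring
      rw [e]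
      exact hTε
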